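/- Let $\mathbf X_j=(X_{1j},\dots,X_{pj})^\top$, $j\in\mathbb Z$, be random elements of $L^2([0,1],\mathbb R^p)$ with $\mathrm E\|\mathbf X_j\|_p^2<\infty$, where $\|\mathbf f\|_p^2=\sum_{i\le p}\int_0^1|f_i(t)|^2\,dt$ and $\langle f,g\rangle=\int_0^1\overline{f(t)}g(t)\,dt$. Assume the series is weakly stationary: $\boldsymbol\mu(t)=\mathrm E\,\mathbf X_j(t)$ and $C_{i_1i_2h}(t,s)=\mathrm{cov}\{X_{i_1(j+h)}(t),X_{i_2j}(s)\}$ do not depend on $j$, and assume $$\sup_{i_1,i_2}\sum_{h\in\mathbb Z}\Big\{\int_0^1\!\!\int_0^1|C_{i_1i_2h}(t,s)|^2\,dt\,ds\Big\}^{1/2}<\infty .$$ Put $\boldsymbol\varepsilon_j=\mathbf X_j-\boldsymbol\mu$, $f_{ii}(t,s\mid\omega)=\frac1{2\pi}\sum_{h\in\mathbb Z}C_{iih}(t,s)e^{\mathrm i h\omega}$ and $f_{\mathcal S}=\frac1p\sum_{i=1}^pf_{ii}$, $\omega\in[-\pi,\pi]$. Let $$f_{\mathcal S}(t,s\mid\omega)=\sum_{k\ge1}\eta_k(\omega)\,\overline{\psi_k(t\mid\omega)}\,\psi_k(s\mid\omega),\qquad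 \eta_1(\omega)\ge\eta_2(\omega)\ge\dots\ge0,$$ be a spectral decomposition (convergent in $L^2([0,1]^2)$), with $\psi_k(\cdot\mid\omega)$, $k\ge1$, orthonormal in $L^2([0,1],\mathbb C)$, jointly measurable in $(t,\omega)$ and chosen so that $\psi_k(\cdot\mid-\omega)=\overline{\psi_k(\cdot\mid\omega)}$. Let $\nu_k:[-\pi,\pi]\to\mathbb C$ be any measurable functions with $|\nu_k(\omega)|=1$ and $\nu_k(\omega)=\overline{\nu_k(-\omega)}$ (for instance $\nu_k\equiv1$), and define the filters $$\phi_{kl}(t)=\frac1{2\pi}\int_{-\pi}^{\pi}\psi_k(t\mid\omega)\,\nu_k(\omega)\,e^{-\mathrm i l\omega}\,d\omega .$$ Infinite sums over $l\in\mathbb Z$ below are mean-square limits of the partial sums over $|l|\le L$ as $L\to\infty$. Then the series $$\xi_{ijk}=\sum_{l\in\mathbb Z}\langle\varepsilon_{i(j-l)},\phi_{kl}\rangle\qquad\text{and}\qquad \sum_{l\in\mathbb Z}\phi_{kl}(\cdot)\,\xi_{i(j+l)k}$$ converge, and the truncation $\varepsilon_{ij}^K=\sum_{k=1}^K\sum_{l\in\mathbb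 Z}\phi_{kl}(\cdot)\,\xi_{i(j+l)k}$ of the marginal dynamic Karhunen–Loève expansion is optimal in the following sense. Let $\mathcal H$ be the class of sequences $(h_l)_{l\in\mathbb Z}$ in $L^2([0,1],\mathbb R)$ for which there is an $H$ with $\int_{-\pi}^{\pi}\|H(\cdot\mid\omega)\|^2d\omega<\infty$ and $\int_{-\pi}^{\pi}\|H(\cdot\mid\omega)-\frac1{2\pi}\sum_{|l|\le L}h_l(\cdot)e^{\mathrm i l\omega}\|^2d\omega\to0$ as $L\to\infty$. For every positive integer $K$, all sequences $(\tilde\phi_{kl})_{l\in\mathbb Z}$, $(\tilde v_{kl})_{l\in\mathbb Z}$ in $\mathcal H$, $k=1,\dots,K$, for which the series $$\tilde\xi_{ijk}=\sum_{l\in\mathbb Z}\langle\varepsilon_{i(j-l)},\tilde v_{kl}\rangle,\qquad \tilde\varepsilon_{ij}^K=\sum_{k=1}^K\sum_{l\in\mathbb Z}\tilde\phi_{kl}(\cdot)\,\tilde\xi_{i(j+l)k}$$ converge in mean square, and every $j\in\mathbb Z$, $$\mathrm E\|\boldsymbol\varepsilon_j-\boldsymbol\varepsilon_j^K\|_p^2\le\mathrm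 E\|\boldsymbol\varepsilon_j-\tilde{\boldsymbol\varepsilon}_j^K\|_p^2 .$$ -/

import Mathlib

open MeasureTheory ProbabilityTheory Filter Topology

noncomputable section

namespace FTS

/-- The frequency domain `[-π, π]` with Lebesgue measure. -/
def freq : Measure ℝ := volume.restrict (Set.Icc (-Real.pi) Real.pi)

/-- `Y` is the mean-square limit, i.e. the limit in `L²(μ)`, of the functions `S 0, S 1, …`. -/
def IsMSLimit {α : Type*} [MeasurableSpace α] (μ : Measure α) (S : ℕ → α → ℂ) (Y : α → ℂ) : Prop :=
  MemLp Y 2 μ ∧ Tendsto (fun L => eLpNorm (fun a => S L a - Y a) 2 μ) atTop (𝓝 0)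

/-- The symmetric partial sum `∑_{|l| ≤ L} a l`. -/
def symSum {E : Type*} [AddCommMonoid E] (a : ℤ → E) (L : ℕ) : E :=
  ∑ l ∈ Finset.Icc (-(L : ℤ)) (L : ℤ), a l

/-- The class `ℋ([0,1], ℝ)` of Fourier-summable filter sequences: real square-integrable `h l`
such that `(1/2π) ∑_{|l| ≤ L} h l (t) exp(i l ω)` converges in `L²([-π, π] × [0,1])`. -/
def FourierSummable (h : ℤ → unitInterval → ℝ) : Prop :=
  (∀ l, MemLp (h l) 2 (volume : Measure unitInterval)) ∧
  ∃ H : ℝ → unitInterval → ℂ,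
    IsMSLimit (freq.prod (volume : Measure unitInterval))
      (fun L z => 1 / (2 * (Real.pi : ℂ)) *
        symSum (fun l : ℤ => (h l z.2 : ℂ) * Complex.exp (Complex.I * l * z.1)) L)
      (fun z => H z.1 z.2)

section Series

variable {Ω : Type*} [MeasurableSpace Ω] {p : ℕ}

/-- The mean function `μ_i(t) = E X_{i0}(t)`. -/
def mean (P : Measure Ω) (X : Fin p → ℤ → Ω → unitInterval → ℝ) (i : Fin p)
    (t : unitInterval) : ℝ :=
  ∫ w, X i 0 w t ∂P

/-- The centred series `ε_{ij}(t) = X_{ij}(t) - μ_i(t)`. -/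
def centred (P : Measure Ω) (X : Fin p → ℤ → Ω → unitInterval → ℝ) (i : Fin p) (j : ℤ)
    (w : Ω) (t : unitInterval) : ℝ :=
  X i j w t - mean P X i t

/-- The autocovariance function `C_{i₁ i₂ h}(t, s) = cov (X_{i₁ h}(t), X_{i₂ 0}(s))`. -/
def autocov (P : Measure Ω) (X : Fin p → ℤ → Ω → unitInterval → ℝ) (i₁ i₂ : Fin p) (h : ℤ)
    (t s : unitInterval) : ℝ :=
  covariance (fun w => X i₁ h w t) (fun w => X i₂ 0 w s) P

/-- `X` is a weakly stationary `p`-dimensional functional time series with values in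
`L²([0,1], ℝ^p)`: second moments are finite, and mean and lagged covariance functions do not
depend on time. -/
structure WeaklyStationary (P : Measure Ω) (X : Fin p → ℤ → Ω → unitInterval → ℝ) : Prop where
  memLp : ∀ i j, MemLp (fun z : Ω × unitInterval => X i j z.1 z.2) 2 (P.prod volume)
  mean_eq : ∀ i j, ∀ᵐ t ∂(volume : Measure unitInterval), ∫ w, X i j w t ∂P = mean P X i t
  cov_eq : ∀ i₁ i₂ j h,
    ∀ᵐ z ∂((volume : Measure unitInterval).prod (volume : Measure unitInterval)),
      covariance (fun w => X i₁ (j + h) w z.1) (fun w => X i₂ j w z.2) P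
        = autocov P X i₁ i₂ h z.1 z.2

/-- `sup_{i₁, i₂} ∑_h {∫∫ |C_{i₁ i₂ h}(t, s)|² dt ds}^{1/2} < ∞`. -/
def SummableAutocov (P : Measure Ω) (X : Fin p → ℤ → Ω → unitInterval → ℝ) : Prop :=
  (⨆ i₁ : Fin p, ⨆ i₂ : Fin p, ∑' h : ℤ,
    eLpNorm (fun z : unitInterval × unitInterval => autocov P X i₁ i₂ h z.1 z.2) 2
      ((volume : Measure unitInterval).prod (volume : Measure unitInterval))) < ⊤

/-- The spectral density `f_{i₁ i₂}(t, s | ω) = (1/2π) ∑_h C_{i₁ i₂ h}(t, s) exp(i h ω)`.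
Under summable autocovariances the series converges absolutely for almost every `(t, s)`,
for all `ω` at once. -/
def spectralDensity (P : Measure Ω) (X : Fin p → ℤ → Ω → unitInterval → ℝ) (i₁ i₂ : Fin p)
    (ω : ℝ) (t s : unitInterval) : ℂ :=
  1 / (2 * (Real.pi : ℂ)) *
    ∑' h : ℤ, (autocov P X i₁ i₂ h t s : ℂ) * Complex.exp (Complex.I * h * ω)

/-- The marginal spectral density `f_S(t, s | ω) = (1/p) ∑_i f_{ii}(t, s | ω)`. -/
def marginalSpectralDensity (P : Measure Ω) (X : Fin p → ℤ → Ω → unitInterval → ℝ)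
    (ω : ℝ) (t s : unitInterval) : ℂ :=
  1 / (p : ℂ) * ∑ i, spectralDensity P X i i ω t s

/-- Partial sums of the score series `ξ_j = ∑_l ⟨ε_{j-l}, v_l⟩`, where
`⟨f, g⟩ = ∫ conj (f t) * g t dt`. -/
def scorePartial (e : ℤ → Ω → unitInterval → ℝ) (v : ℤ → unitInterval → ℂ) (j : ℤ) (L : ℕ)
    (w : Ω) : ℂ :=
  symSum (fun l : ℤ => ∫ t, (starRingEnd ℂ) (e (j - l) w t : ℂ) * v l t) L

/-- Partial sums of the reconstruction series `∑_l φ_l(t) ξ_{j+l}`. -/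
def reconPartial (φ : ℤ → unitInterval → ℂ) (ξ : ℤ → Ω → ℂ) (j : ℤ) (L : ℕ)
    (z : Ω × unitInterval) : ℂ :=
  symSum (fun l : ℤ => φ l z.2 * ξ (j + l) z.1) L

/-- `ξ i j k` are the scores `∑_l ⟨ε_{i(j-l)}, v_{kl}⟩` and `Y i j k` the components
`∑_l φ_{kl} ξ_{i(j+l)k}`, both bi-infinite series converging in mean square. -/
structure IsFilterExpansion {κ : Type*} (P : Measure Ω) (e : Fin p → ℤ → Ω → unitInterval → ℝ)
    (φ v : κ → ℤ → unitInterval → ℂ) (ξ : Fin p → ℤ → κ → Ω → ℂ)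
    (Y : Fin p → ℤ → κ → Ω → unitInterval → ℂ) : Prop where
  score : ∀ i j k, IsMSLimit P (scorePartial (e i) (v k) j) (ξ i j k)
  recon : ∀ i j k, IsMSLimit (P.prod volume)
    (reconPartial (φ k) (fun m => ξ i m k) j) (fun z => Y i j k z.1 z.2)

/-- The mean squared error `E ‖e - Y‖_p² = E ∑_i ∫ |e_i(t) - Y_i(t)|² dt`. -/
def meanSqError (P : Measure Ω) (e : Fin p → Ω → unitInterval → ℝ)
    (Y : Fin p → Ω → unitInterval → ℂ) : ENNReal :=
  ∫⁻ w, (∑ i, ∫⁻ t, ‖(e i w t : ℂ) - Y i w t‖ₑ ^ 2) ∂P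

end Series

/-- `g(t, s | ω) = ∑_k η_k(ω) conj (ψ_k(t | ω)) ψ_k(s | ω)` is a spectral decomposition (for almost
every frequency, convergence in `L²([0,1]²)`) of the Hermitian kernels `g(·, · | ω)`, with
eigenvalues in decreasing order and orthonormal eigenfunctions that are jointly measurable and
chosen with `ψ_k(· | -ω) = conj (ψ_k(· | ω))`. The index `k = 0` is the leading one. -/
structure IsSpectralDecomposition (g : ℝ → unitInterval → unitInterval → ℂ)
    (η : ℕ → ℝ → ℝ) (ψ : ℕ → ℝ → unitInterval → ℂ) : Prop where
  aestronglyMeasurable : ∀ k, AEStronglyMeasurable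
    (fun z : ℝ × unitInterval => ψ k z.1 z.2) (freq.prod volume)
  memLp : ∀ᵐ ω ∂freq, ∀ k, MemLp (ψ k ω) 2 volume
  orthonormal : ∀ᵐ ω ∂freq, ∀ k m,
    ∫ t, (starRingEnd ℂ) (ψ k ω t) * ψ m ω t = if k = m then 1 else 0
  nonneg : ∀ᵐ ω ∂freq, ∀ k, 0 ≤ η k ω
  antitone : ∀ᵐ ω ∂freq, Antitone (fun k => η k ω)
  expansion : ∀ᵐ ω ∂freq, Tendsto
    (fun n : ℕ => eLpNorm (fun z : unitInterval × unitInterval =>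
        g ω z.1 z.2 -
          ∑ k ∈ Finset.range n, (η k ω : ℂ) * (starRingEnd ℂ) (ψ k ω z.1) * ψ k ω z.2) 2
      ((volume : Measure unitInterval).prod (volume : Measure unitInterval))) atTop (𝓝 0)
  conj_symm : ∀ k, ∀ᵐ ω ∂freq, ∀ᵐ t ∂(volume : Measure unitInterval),
    ψ k (-ω) t = (starRingEnd ℂ) (ψ k ω t)

/-- The class of (measurable) multipliers with values on the complex unit circle and
`ν(ω) = conj (ν(-ω))`. -/
structure IsUnitMultiplier (ν : ℝ → ℂ) : Prop where
  aestronglyMeasurable : AEStronglyMeasurable ν freq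
  norm_eq_one : ∀ ω ∈ Set.Icc (-Real.pi) Real.pi, ‖ν ω‖ = 1
  conj_symm : ∀ ω ∈ Set.Icc (-Real.pi) Real.pi, ν ω = (starRingEnd ℂ) (ν (-ω))

/-- The functional filters `φ_l(t) = (1/2π) ∫_{-π}^{π} ψ(t | ω) ν(ω) exp(-i l ω) dω`. -/
def functionalFilter (ψ : ℝ → unitInterval → ℂ) (ν : ℝ → ℂ) (l : ℤ) (t : unitInterval) : ℂ :=
  1 / (2 * (Real.pi : ℂ)) * ∫ ω, ψ ω t * ν ω * Complex.exp (-(Complex.I * l * ω)) ∂freq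

end FTS

end

/-!
The proof compares mean squared errors frequency by frequency.

Let `F(ω)` be the sum over the components `i` of the spectral density operators. A filter
expansion with `K` terms acts at frequency `ω` as an operator `A(ω)` of rank at most `K`, and the
error is `∫ tr ((1 - A) F (1 - A)*) dω`. To avoid trace-class operators, only the difference to
the error of the zero expansion is used: this is the integral of
`excess F Φ W = tr (A F A*) - 2 Re tr (A F)`, a finite sum of inner products
(`IsCovariance.norm_sub_reconSum_sq`). At each frequency, completing the square on an orthonormal
basis of the range of `A` and Ky Fan's maximum principle give
`excess F Φ W ≥ -∑_{k < K} p η_k(ω)` (`HasWeakExpansion.neg_sum_le_excess`), with equality for the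
projection onto the leading eigenfunctions (`HasWeakExpansion.excess_eigen`), which is how the
filters `φ_{kl}` act.

The frequency formula is proved for finitely many lags only, where it reduces to Fourier inversion
of the operator-valued function `F`, continuous because the autocovariances are summable. The
error of an infinite expansion is a limit of errors of finite ones: the score series is truncated
first for a fixed number of lags in the reconstruction, which then tends to infinity. For a
competitor this follows from the assumed mean-square convergence, so that its transfer functions
need not be studied. For the optimal filters, whose transfer functions `ψ_k ν_k` have norm one at
each frequency, Parseval's identity gives convergence of the Fourier series of `ψ_k ν_k`; the
convergence of both series follows, and `abs_excess_sub_le` controls the truncated errors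
(`sum_norm_sub_sq_le`).

The filters are real, by the symmetry `ψ_k(-ω) = conj ψ_k(ω)` for the optimal ones; this is used to
identify `⟨ε_j, φ ⊗ x⟩` with the inner product of `⟨ε_j, φ⟩` and `x` (`inner_toLp_tensorLp`).
-/

noncomputable section
open scoped InnerProductSpace ComplexConjugate

namespace FTS

/-! ### Optimality at a fixed frequency -/

section Fibre

variable {H : Type*} [NormedAddCommGroup H] [InnerProductSpace ℂ H]

/-- For the finite-rank operator `A = ∑ k, |Φ k⟩⟨W k|` and the covariance operator `F`, this is
`tr ((1 - A) F (1 - A)*) - tr F`, the change in mean squared error when `0` is replaced by the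
reconstruction `A`. It is written without traces, so that `F` need not be of trace class. -/
def excess {κ : Type*} [Fintype κ] (F : H →L[ℂ] H) (Φ W : κ → H) : ℝ :=
  (∑ k, ∑ k', ⟪Φ k, Φ k'⟫_ℂ * ⟪W k', F (W k)⟫_ℂ).re - 2 * (∑ k, ⟪Φ k, F (W k)⟫_ℂ).re

lemma excess_sum {κ ι : Type*} [Fintype κ] [Fintype ι] (F : ι → H →L[ℂ] H) (Φ W : κ → H) :
    excess (∑ i, F i) Φ W = ∑ i, excess (F i) Φ W := by
  have h1 : ∑ k, ∑ k', ⟪Φ k, Φ k'⟫_ℂ * ⟪W k', (∑ i, F i) (W k)⟫_ℂ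
      = ∑ i, ∑ k, ∑ k', ⟪Φ k, Φ k'⟫_ℂ * ⟪W k', F i (W k)⟫_ℂ := by
    simp only [sum_apply, inner_sum, Finset.mul_sum]
    exact (Finset.sum_congr rfl fun k _ => Finset.sum_comm).trans Finset.sum_comm
  have h2 : ∑ k, ⟪Φ k, (∑ i, F i) (W k)⟫_ℂ = ∑ i, ∑ k, ⟪Φ k, F i (W k)⟫_ℂ := by
    simp only [sum_apply, inner_sum]
    exact Finset.sum_comm
  simp only [excess, h1, h2, Complex.re_sum, Finset.sum_sub_distrib, Finset.mul_sum]

/-- `F` has eigenvalues `η` and orthonormal eigenvectors `e`, in the weak sense. -/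
def HasWeakExpansion (F : H →L[ℂ] H) (η : ℕ → ℝ) (e : ℕ → H) : Prop :=
  ∀ u v, Tendsto (fun n : ℕ => ∑ k ∈ Finset.range n, (η k : ℂ) * (⟪v, e k⟫_ℂ * ⟪e k, u⟫_ℂ))
    atTop (𝓝 ⟪v, F u⟫_ℂ)

variable {F : H →L[ℂ] H} {η : ℕ → ℝ} {e : ℕ → H}

lemma HasWeakExpansion.conj_inner (h : HasWeakExpansion F η e) (u v : H) :
    conj ⟪v, F u⟫_ℂ = ⟪u, F v⟫_ℂ := by
  refine tendsto_nhds_unique ((Complex.continuous_conj.tendsto _).comp (h u v)) ?_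
  refine (h v u).congr fun n => ?_
  simp only [Function.comp, map_sum, map_mul, inner_conj_symm, Complex.conj_ofReal]
  exact Finset.sum_congr rfl fun k _ => by ring

lemma HasWeakExpansion.tendsto_re (h : HasWeakExpansion F η e) (u : H) :
    Tendsto (fun n : ℕ => ∑ k ∈ Finset.range n, η k * ‖⟪e k, u⟫_ℂ‖ ^ 2)
      atTop (𝓝 (⟪u, F u⟫_ℂ).re) := by
  refine ((Complex.continuous_re.tendsto _).comp (h u u)).congr fun n => ?_
  simp only [Function.comp, Complex.re_sum]
  refine Finset.sum_congr rfl fun k _ => ?_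
  rw [← inner_conj_symm u (e k), mul_comm (conj _), Complex.mul_conj, ← Complex.ofReal_mul,
    Complex.ofReal_re, Complex.normSq_eq_norm_sq]

lemma HasWeakExpansion.re_nonneg (h : HasWeakExpansion F η e) (hη : ∀ k, 0 ≤ η k) (u : H) :
    0 ≤ (⟪u, F u⟫_ℂ).re :=
  ge_of_tendsto' (h.tendsto_re u) fun _ => Finset.sum_nonneg fun k _ =>
    mul_nonneg (hη k) (sq_nonneg _)

lemma HasWeakExpansion.inner_eigen (h : HasWeakExpansion F η e) (he : Orthonormal ℂ e)
    (v : H) (m : ℕ) : ⟪v, F (e m)⟫_ℂ = η m * ⟪v, e m⟫_ℂ := by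
  refine tendsto_nhds_unique (h (e m) v) (tendsto_const_nhds.congr' ?_)
  filter_upwards [eventually_gt_atTop m] with n hn
  rw [Finset.sum_eq_single_of_mem m (Finset.mem_range.2 hn)]
  · simp [he.1 m]
  · intro k _ hk
    simp [he.2 hk]

/-- Ky Fan's maximum principle: the first `K` eigenvalues bound the sum of `⟪b, F b⟫` over any
orthonormal family of at most `K` vectors. -/
lemma HasWeakExpansion.kyFan (h : HasWeakExpansion F η e) (he : Orthonormal ℂ e)
    (hη : ∀ k, 0 ≤ η k) (hanti : Antitone η) {ι : Type*} [Fintype ι] {b : ι → H}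
    (hb : Orthonormal ℂ b) {K : ℕ} (hK : Fintype.card ι ≤ K) :
    ∑ m, (⟪b m, F (b m)⟫_ℂ).re ≤ ∑ k ∈ Finset.range K, η k := by
  have hlim := tendsto_finsetSum Finset.univ fun m (_ : m ∈ Finset.univ) => h.tendsto_re (b m)
  refine le_of_tendsto hlim ?_
  filter_upwards [eventually_ge_atTop K] with n hn
  -- the weights `w k` lie in `[0, 1]` and their sum is at most `K`
  set w : ℕ → ℝ := fun k => ∑ m, ‖⟪e k, b m⟫_ℂ‖ ^ 2 with hw
  have hw0 : ∀ k, 0 ≤ w k := fun k => Finset.sum_nonneg fun _ _ => sq_nonneg _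
  have hw1 : ∀ k, w k ≤ 1 := fun k => by
    have := hb.sum_inner_products_le (s := Finset.univ) (e k)
    simp only [he.1 k, one_pow] at this
    refine le_trans (le_of_eq ?_) this
    exact Finset.sum_congr rfl fun m _ => by rw [norm_inner_symm]
  have hwK : ∑ k ∈ Finset.range n, w k ≤ K := by
    rw [Finset.sum_comm]
    calc ∑ m, ∑ k ∈ Finset.range n, ‖⟪e k, b m⟫_ℂ‖ ^ 2 ≤ ∑ _m : ι, (1 : ℝ) := by
          refine Finset.sum_le_sum fun m _ => ?_
          have := he.sum_inner_products_le (s := Finset.range n) (b m)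
          simpa only [hb.1 m, one_pow] using this
      _ ≤ K := by simpa using hK
  have e1 : ∑ m, ∑ k ∈ Finset.range n, η k * ‖⟪e k, b m⟫_ℂ‖ ^ 2
      = ∑ k ∈ Finset.range n, η k * w k := by
    rw [Finset.sum_comm]
    simp only [hw, Finset.mul_sum]
  rw [e1]
  have e2 : ∑ k ∈ Finset.range n, (η k - η K) * w k ≤ ∑ k ∈ Finset.range K, (η k - η K) := by
    rw [← Finset.sum_range_add_sum_Ico _ hn]
    have i1 : ∑ k ∈ Finset.range K, (η k - η K) * w k ≤ ∑ k ∈ Finset.range K, (η k - η K) := by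
      refine Finset.sum_le_sum fun k hk => ?_
      have := sub_nonneg.2 (hanti (Finset.mem_range.1 hk).le)
      nlinarith [hw1 k]
    have i2 : ∑ k ∈ Finset.Ico K n, (η k - η K) * w k ≤ 0 := by
      refine Finset.sum_nonpos fun k hk => ?_
      have := hanti (Finset.mem_Ico.1 hk).1
      nlinarith [hw0 k]
    linarith
  simp only [sub_mul, Finset.sum_sub_distrib, ← Finset.mul_sum, Finset.sum_const,
    Finset.card_range, nsmul_eq_mul] at e2
  nlinarith [hη K]

/-- No reconstruction of rank at most `K` lowers the error by more than the first `K`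
eigenvalues: on an orthonormal basis `b` of the span of `Φ`, completing the square leaves
`-∑ ⟪b, F b⟫`, and Ky Fan's principle applies. -/
lemma HasWeakExpansion.neg_sum_le_excess (h : HasWeakExpansion F η e) (he : Orthonormal ℂ e)
    (hη : ∀ k, 0 ≤ η k) (hanti : Antitone η) {K : ℕ} (Φ W : Fin K → H) :
    -∑ k ∈ Finset.range K, η k ≤ excess F Φ W := by
  set U : Submodule ℂ H := Submodule.span ℂ (Set.range Φ) with hU
  have hfin : FiniteDimensional ℂ U := FiniteDimensional.span_of_finite ℂ (Set.finite_range Φ)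
  let b := stdOrthonormalBasis ℂ U
  let c : Fin (Module.finrank ℂ U) → H := fun m => (b m : H)
  have hc : Orthonormal ℂ c := b.orthonormal.comp_linearIsometry U.subtypeₗᵢ
  have hcard : Fintype.card (Fin (Module.finrank ℂ U)) ≤ K := by
    have := finrank_range_le_card (R := ℂ) Φ
    rwa [Set.finrank, Fintype.card_fin, ← Fintype.card_fin (Module.finrank _ _)] at this
  have hexp : ∀ k (x : H), ⟪Φ k, x⟫_ℂ = ∑ m, ⟪Φ k, c m⟫_ℂ * ⟪c m, x⟫_ℂ := by
    intro k x
    have hk : Φ k ∈ U := Submodule.subset_span ⟨k, rfl⟩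
    have := congrArg (fun z : U => (z : H)) (b.sum_repr' ⟨Φ k, hk⟩)
    simp only [Submodule.coe_sum, Submodule.coe_smul, Submodule.coe_inner] at this
    conv_lhs => rw [← this, sum_inner]
    refine Finset.sum_congr rfl fun m _ => ?_
    rw [inner_smul_left, inner_conj_symm]
  let g : Fin (Module.finrank ℂ U) → H := fun m => ∑ k, ⟪Φ k, c m⟫_ℂ • W k
  have q1 : ∑ k, ∑ k', ⟪Φ k, Φ k'⟫_ℂ * ⟪W k', F (W k)⟫_ℂ = ∑ m, ⟪g m, F (g m)⟫_ℂ := by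
    have hg : ∀ m, ⟪g m, F (g m)⟫_ℂ
        = ∑ k, ∑ k', ⟪Φ k, c m⟫_ℂ * ⟪c m, Φ k'⟫_ℂ * ⟪W k', F (W k)⟫_ℂ := fun m => by
      simp only [g, map_sum, map_smul, inner_sum, sum_inner, inner_smul_left, inner_smul_right,
        inner_conj_symm, Finset.mul_sum]
      exact Finset.sum_congr rfl fun k _ => Finset.sum_congr rfl fun k' _ => by ring
    simp only [hg]
    simp_rw [hexp _ (Φ _), Finset.sum_mul]
    exact (Finset.sum_congr rfl fun k _ => Finset.sum_comm).trans Finset.sum_comm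
  have q2 : ∑ k, ⟪Φ k, F (W k)⟫_ℂ = ∑ m, ⟪c m, F (g m)⟫_ℂ := by
    simp only [g, map_sum, map_smul, inner_sum, inner_smul_right]
    rw [Finset.sum_comm]
    exact Finset.sum_congr rfl fun k _ => hexp k _
  have hky := h.kyFan he hη hanti hc hcard
  have hsq : ∀ m, -(⟪c m, F (c m)⟫_ℂ).re ≤ (⟪g m, F (g m)⟫_ℂ).re - 2 * (⟪c m, F (g m)⟫_ℂ).re := by
    intro m
    have h0 := h.re_nonneg hη (g m - c m)
    have h1 : (⟪g m, F (c m)⟫_ℂ).re = (⟪c m, F (g m)⟫_ℂ).re := by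
      rw [← h.conj_inner (g m) (c m), Complex.conj_re]
    simp only [map_sub, inner_sub_left, inner_sub_right, Complex.sub_re] at h0
    linarith
  have := Finset.sum_le_sum fun m (_ : m ∈ Finset.univ) => hsq m
  rw [excess, q1, q2, Complex.re_sum, Complex.re_sum, Finset.mul_sum, ← Finset.sum_sub_distrib]
  rw [Finset.sum_neg_distrib] at this
  linarith

/-- The bound is attained by the leading eigenvectors, up to unimodular factors. -/
lemma HasWeakExpansion.excess_eigen (h : HasWeakExpansion F η e) (he : Orthonormal ℂ e)
    {K : ℕ} {c : Fin K → ℂ} (hc : ∀ k, ‖c k‖ = 1) :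
    excess F (fun k => c k • e k) (fun k => c k • e k) = -∑ k ∈ Finset.range K, η k := by
  have hcc : ∀ k, conj (c k) * c k = 1 := fun k => by
    rw [mul_comm, Complex.mul_conj, Complex.normSq_eq_norm_sq, hc]; simp
  have horth : ∀ k k' : Fin K, ⟪e k, e k'⟫_ℂ = if k = k' then 1 else 0 := fun k k' => by
    rw [orthonormal_iff_ite.1 he]; simp [Fin.ext_iff]
  have q2 : ∀ k : Fin K, ⟪c k • e k, F (c k • e k)⟫_ℂ = η k := fun k => by
    rw [map_smul, inner_smul_left, inner_smul_right, h.inner_eigen he, horth, ← mul_assoc, hcc]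
    simp
  have q1 : ∀ k : Fin K, ∑ k' : Fin K,
      ⟪c k • e k, c k' • e k'⟫_ℂ * ⟪c k' • e k', F (c k • e k)⟫_ℂ = η k := fun k => by
    rw [Finset.sum_eq_single k, q2, inner_smul_left, inner_smul_right, horth, ← mul_assoc, hcc]
    · simp
    · intro k' _ hk
      rw [inner_smul_left, inner_smul_right, horth, if_neg hk.symm]; simp
    · simp
  simp only [excess, q1, q2, ← Complex.ofReal_sum, Complex.ofReal_re]
  rw [Finset.sum_range]
  ring

/-- Continuity of `excess` near unit vectors. -/
lemma abs_excess_sub_le {κ : Type*} [Fintype κ] {B c : ℝ} (hF : ‖F‖ ≤ B) (hc : 1 ≤ c)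
    {Φ W V : κ → H} (hΦ : ∀ k, ‖Φ k‖ ≤ c) (hV : ∀ k, ‖V k‖ = 1) :
    |excess F Φ W - excess F V V| ≤ (2 * Fintype.card κ + 2) * B *
      ∑ k, (c ^ 2 * (‖W k - V k‖ + ‖W k - V k‖ ^ 2) + (‖Φ k - V k‖ + ‖Φ k - V k‖ ^ 2)) := by
  have hB : 0 ≤ B := (norm_nonneg F).trans hF
  have hFi : ∀ x y : H, ‖⟪x, F y⟫_ℂ‖ ≤ B * ‖x‖ * ‖y‖ := fun x y => by
    calc ‖⟪x, F y⟫_ℂ‖ ≤ ‖x‖ * ‖F y‖ := norm_inner_le_norm _ _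
      _ ≤ ‖x‖ * (B * ‖y‖) := by gcongr; exact F.le_of_opNorm_le hF y
      _ = _ := by ring
  set β : κ → ℝ := fun k => ‖W k - V k‖ + ‖W k - V k‖ ^ 2 with hβ
  set α : κ → ℝ := fun k => ‖Φ k - V k‖ + ‖Φ k - V k‖ ^ 2 with hα
  have hΦ' : ∀ k, ‖Φ k‖ ≤ 1 + ‖Φ k - V k‖ := fun k => by
    calc ‖Φ k‖ = ‖V k + (Φ k - V k)‖ := by congr 1; abel
      _ ≤ _ := (norm_add_le _ _).trans (by rw [hV])
  have hW' : ∀ k, ‖W k‖ ≤ 1 + ‖W k - V k‖ := fun k => by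
    calc ‖W k‖ = ‖V k + (W k - V k)‖ := by congr 1; abel
      _ ≤ _ := (norm_add_le _ _).trans (by rw [hV])
  have t1 : ∀ k k', ‖⟪Φ k, Φ k'⟫_ℂ * ⟪W k', F (W k)⟫_ℂ - ⟪V k, V k'⟫_ℂ * ⟪V k', F (V k)⟫_ℂ‖
      ≤ B * ((c ^ 2 * β k + α k) + (c ^ 2 * β k' + α k')) := by
    intro k k'
    have e1 : ⟪Φ k, Φ k'⟫_ℂ * ⟪W k', F (W k)⟫_ℂ - ⟪V k, V k'⟫_ℂ * ⟪V k', F (V k)⟫_ℂ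
        = ⟪Φ k, Φ k'⟫_ℂ * (⟪W k' - V k', F (W k)⟫_ℂ + ⟪V k', F (W k - V k)⟫_ℂ)
          + (⟪Φ k - V k, Φ k'⟫_ℂ + ⟪V k, Φ k' - V k'⟫_ℂ) * ⟪V k', F (V k)⟫_ℂ := by
      simp only [map_sub, inner_sub_left, inner_sub_right]; ring
    have n1 : ‖⟪Φ k, Φ k'⟫_ℂ‖ ≤ c ^ 2 := by
      calc _ ≤ ‖Φ k‖ * ‖Φ k'‖ := norm_inner_le_norm _ _
        _ ≤ c * c := by gcongr <;> apply hΦ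
        _ = _ := by ring
    have n2 : ‖⟪W k' - V k', F (W k)⟫_ℂ + ⟪V k', F (W k - V k)⟫_ℂ‖ ≤ B * (β k + β k') := by
      refine (norm_add_le _ _).trans ?_
      have h1 := hFi (W k' - V k') (W k)
      have h2 := hFi (V k') (W k - V k)
      rw [hV, mul_one] at h2
      have h3 : B * ‖W k' - V k'‖ * ‖W k‖ ≤ B * (‖W k' - V k'‖ * (1 + ‖W k - V k‖)) := by
        rw [mul_assoc]; gcongr; exact hW' k
      have h4 : ‖W k' - V k'‖ * (1 + ‖W k - V k‖) + ‖W k - V k‖ ≤ β k + β k' := by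
        simp only [hβ]; nlinarith [sq_nonneg (‖W k' - V k'‖ - ‖W k - V k‖)]
      nlinarith
    have n3 : ‖⟪Φ k - V k, Φ k'⟫_ℂ + ⟪V k, Φ k' - V k'⟫_ℂ‖ ≤ α k + α k' := by
      refine (norm_add_le _ _).trans ?_
      have h1 := norm_inner_le_norm (𝕜 := ℂ) (Φ k - V k) (Φ k')
      have h2 := norm_inner_le_norm (𝕜 := ℂ) (V k) (Φ k' - V k')
      rw [hV, one_mul] at h2
      have h3 : ‖Φ k - V k‖ * ‖Φ k'‖ ≤ ‖Φ k - V k‖ * (1 + ‖Φ k' - V k'‖) := by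
        gcongr; exact hΦ' k'
      simp only [hα]; nlinarith [sq_nonneg (‖Φ k - V k‖ - ‖Φ k' - V k'‖)]
    have n4 : ‖⟪V k', F (V k)⟫_ℂ‖ ≤ B := by simpa [hV] using hFi (V k') (V k)
    rw [e1]
    refine (norm_add_le _ _).trans ?_
    rw [norm_mul, norm_mul]
    calc _ ≤ c ^ 2 * (B * (β k + β k')) + (α k + α k') * B := by gcongr
      _ = _ := by ring
  have t2 : ∀ k, ‖⟪Φ k, F (W k)⟫_ℂ - ⟪V k, F (V k)⟫_ℂ‖ ≤ B * (c ^ 2 * β k + α k) := by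
    intro k
    have e1 : ⟪Φ k, F (W k)⟫_ℂ - ⟪V k, F (V k)⟫_ℂ
        = ⟪Φ k, F (W k - V k)⟫_ℂ + ⟪Φ k - V k, F (V k)⟫_ℂ := by
      simp only [map_sub, inner_sub_left, inner_sub_right]; ring
    rw [e1]
    refine (norm_add_le _ _).trans ?_
    have h1 := hFi (Φ k) (W k - V k)
    have h2 := hFi (Φ k - V k) (V k)
    rw [hV, mul_one] at h2
    have h3 : B * ‖Φ k‖ * ‖W k - V k‖ ≤ B * (c ^ 2 * ‖W k - V k‖) := by
      rw [mul_assoc]; gcongr; exact (hΦ k).trans (by nlinarith)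
    have h4 : B * (c ^ 2 * ‖W k - V k‖) + B * ‖Φ k - V k‖ ≤ B * (c ^ 2 * β k + α k) := by
      rw [← mul_add]
      gcongr <;> simp only [hα, hβ] <;> nlinarith [sq_nonneg ‖W k - V k‖, sq_nonneg ‖Φ k - V k‖]
    linarith
  have e0 : excess F Φ W - excess F V V = (∑ k, ∑ k', (⟪Φ k, Φ k'⟫_ℂ * ⟪W k', F (W k)⟫_ℂ
      - ⟪V k, V k'⟫_ℂ * ⟪V k', F (V k)⟫_ℂ)).re
      - 2 * (∑ k, (⟪Φ k, F (W k)⟫_ℂ - ⟪V k, F (V k)⟫_ℂ)).re := by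
    simp only [excess, Finset.sum_sub_distrib, Complex.sub_re]; ring
  have s1 : ‖∑ k, ∑ k', (⟪Φ k, Φ k'⟫_ℂ * ⟪W k', F (W k)⟫_ℂ
      - ⟪V k, V k'⟫_ℂ * ⟪V k', F (V k)⟫_ℂ)‖
      ≤ 2 * Fintype.card κ * B * ∑ k, (c ^ 2 * β k + α k) := by
    calc _ ≤ ∑ k, ∑ k', B * ((c ^ 2 * β k + α k) + (c ^ 2 * β k' + α k')) :=
          (norm_sum_le _ _).trans (Finset.sum_le_sum fun k _ =>
            (norm_sum_le _ _).trans (Finset.sum_le_sum fun k' _ => t1 k k'))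
      _ = _ := by
        simp only [← Finset.mul_sum, Finset.sum_add_distrib, Finset.sum_const, Finset.card_univ,
          nsmul_eq_mul]
        ring
  have s2 : ‖∑ k, (⟪Φ k, F (W k)⟫_ℂ - ⟪V k, F (V k)⟫_ℂ)‖ ≤ B * ∑ k, (c ^ 2 * β k + α k) := by
    rw [Finset.mul_sum]
    exact (norm_sum_le _ _).trans (Finset.sum_le_sum fun k _ => t2 k)
  rw [e0]
  refine (abs_sub _ _).trans ?_
  rw [abs_mul, abs_two]
  have := (Complex.abs_re_le_norm _).trans s1
  have := (Complex.abs_re_le_norm _).trans s2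
  nlinarith

end Fibre

/-! ### Characters on the frequency domain -/

section Frequency

instance : IsFiniteMeasure freq := by unfold freq; infer_instance

/-- The character `ω ↦ exp (i l ω)`. -/
def char (l : ℤ) (ω : ℝ) : ℂ := Complex.exp (Complex.I * l * ω)

lemma char_add (l m : ℤ) (ω : ℝ) : char (l + m) ω = char l ω * char m ω := by
  simp only [char, ← Complex.exp_add]; push_cast; ring_nf

lemma char_zero (ω : ℝ) : char 0 ω = 1 := by simp [char]

lemma conj_char (l : ℤ) (ω : ℝ) : conj (char l ω) = char (-l) ω := by
  simp only [char, ← Complex.exp_conj]; simp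

lemma norm_char (l : ℤ) (ω : ℝ) : ‖char l ω‖ = 1 := by
  have : char l ω = Complex.exp ((l * ω : ℝ) * Complex.I) := by
    simp only [char]; push_cast; ring_nf
  rw [this, Complex.norm_exp_ofReal_mul_I]

@[fun_prop]
lemma continuous_char (l : ℤ) : Continuous (char l) := by unfold char; fun_prop

lemma integral_freq (f : ℝ → ℂ) : ∫ ω, f ω ∂freq = ∫ ω in (-Real.pi)..Real.pi, f ω := by
  rw [freq, integral_Icc_eq_integral_Ioc,
    intervalIntegral.integral_of_le (by linarith [Real.pi_pos])]

lemma integral_char (l : ℤ) : ∫ ω, char l ω ∂freq = if l = 0 then 2 * (Real.pi : ℂ) else 0 := by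
  rw [integral_freq]
  split_ifs with h
  · subst h
    simp only [char_zero, intervalIntegral.integral_const]
    simp; ring
  · have hl : Complex.I * l ≠ 0 := mul_ne_zero Complex.I_ne_zero (by exact_mod_cast h)
    simp only [char]
    rw [integral_exp_mul_complex hl, div_eq_zero_iff]
    left
    rw [sub_eq_zero, Complex.exp_eq_exp_iff_exists_int]
    exact ⟨l, by push_cast; ring⟩

lemma integrable_freq {E : Type*} [NormedAddCommGroup E] {f : ℝ → E} (hf : Continuous f) :
    Integrable f freq :=
  hf.continuousOn.integrableOn_compact isCompact_Icc

end Frequency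

/-! ### Trigonometric polynomials and spectral operators -/

section Trig

variable {H : Type*} [NormedAddCommGroup H] [InnerProductSpace ℂ H]

/-- The trigonometric polynomial `∑_{l ∈ s} exp (i l ω) v l`. -/
def trig (s : Finset ℤ) (v : ℤ → H) (ω : ℝ) : H := ∑ l ∈ s, char l ω • v l

@[fun_prop]
lemma continuous_trig (s : Finset ℤ) (v : ℤ → H) : Continuous (trig s v) := by
  unfold trig; fun_prop

lemma norm_trig_le (s : Finset ℤ) (v : ℤ → H) (ω : ℝ) : ‖trig s v ω‖ ≤ ∑ l ∈ s, ‖v l‖ :=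
  (norm_sum_le _ _).trans (Finset.sum_le_sum fun l _ => by rw [norm_smul, norm_char, one_mul])

lemma inner_trig (s s' : Finset ℤ) (v v' : ℤ → H) (G : H →L[ℂ] H) (ω : ℝ) :
    ⟪trig s' v' ω, G (trig s v ω)⟫_ℂ
      = ∑ m' ∈ s', ∑ m ∈ s, char (m - m') ω * ⟪v' m', G (v m)⟫_ℂ := by
  simp only [trig, map_sum, map_smul, inner_sum, sum_inner, inner_smul_left, inner_smul_right,
    conj_char, Finset.mul_sum]
  refine (Finset.sum_comm).trans
    (Finset.sum_congr rfl fun m' _ => Finset.sum_congr rfl fun m _ => ?_)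
  rw [sub_eq_add_neg, char_add]; ring

lemma integral_norm_trig_sq (s : Finset ℤ) (v : ℤ → H) :
    ∫ ω, ‖trig s v ω‖ ^ 2 ∂freq = 2 * Real.pi * ∑ l ∈ s, ‖v l‖ ^ 2 := by
  have h : ∀ ω, ((‖trig s v ω‖ ^ 2 : ℝ) : ℂ)
      = ∑ m' ∈ s, ∑ m ∈ s, char (m - m') ω * ⟪v m', v m⟫_ℂ := fun ω => by
    simpa using inner_trig s s v v (ContinuousLinearMap.id ℂ H) ω
  rw [← Complex.ofReal_inj, ← integral_complex_ofReal]
  simp only [h]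
  rw [integral_finsetSum _ fun m' _ => integrable_freq (by fun_prop), Complex.ofReal_mul,
    Complex.ofReal_sum, Finset.mul_sum]
  refine Finset.sum_congr rfl fun m' hm' => ?_
  rw [integral_finsetSum _ fun m _ => integrable_freq (by fun_prop),
    Finset.sum_eq_single_of_mem m' hm']
  · rw [integral_mul_const, integral_char]
    simp
  · intro m _ hm
    rw [integral_mul_const, integral_char, if_neg (sub_ne_zero.2 hm), zero_mul]

/-- The operator `(1/2π) ∑_h exp (i h ω) A h` with Fourier coefficients `A h`. -/
def spectralOp (A : ℤ → H →L[ℂ] H) (ω : ℝ) : H →L[ℂ] H :=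
  (1 / (2 * (Real.pi : ℂ))) • ∑' h, char h ω • A h

variable [CompleteSpace H] {A : ℤ → H →L[ℂ] H}

lemma summable_char_smul (hA : Summable fun h => ‖A h‖) (ω : ℝ) :
    Summable fun h => char h ω • A h :=
  Summable.of_norm (by simpa only [norm_smul, norm_char, one_mul] using hA)

lemma continuous_spectralOp (hA : Summable fun h => ‖A h‖) : Continuous (spectralOp A) := by
  have h : Continuous fun ω => ∑' h, char h ω • A h :=
    continuous_tsum (fun h => (continuous_char h).smul continuous_const) hA fun h ω => by
      rw [norm_smul, norm_char, one_mul]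
  exact (continuous_const (y := (1 / (2 * (Real.pi : ℂ))))).smul h

lemma norm_spectralOp_le (hA : Summable fun h => ‖A h‖) (ω : ℝ) :
    ‖spectralOp A ω‖ ≤ ∑' h, ‖A h‖ := by
  have h1 : ‖∑' h, char h ω • A h‖ ≤ ∑' h, ‖A h‖ :=
    tsum_of_norm_bounded hA.hasSum fun h => by rw [norm_smul, norm_char, one_mul]
  have h2 : ‖1 / (2 * (Real.pi : ℂ))‖ ≤ 1 := by
    rw [norm_div, norm_mul, Complex.norm_real, Real.norm_of_nonneg Real.pi_pos.le]
    simp only [norm_one, Complex.norm_ofNat]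
    rw [div_le_one (by positivity)]
    linarith [Real.pi_gt_three]
  rw [spectralOp, norm_smul]
  exact (mul_le_of_le_one_left (norm_nonneg _) h2).trans h1

lemma hasSum_inner_spectralOp (hA : Summable fun h => ‖A h‖) (ω : ℝ) (u v : H) :
    HasSum (fun h => 1 / (2 * (Real.pi : ℂ)) * (char h ω * ⟪v, A h u⟫_ℂ))
      ⟪v, spectralOp A ω u⟫_ℂ := by
  have h1 := (summable_char_smul hA ω).hasSum
  have h2 := ((ContinuousLinearMap.apply ℂ H u).hasSum h1).const_smul (1 / (2 * (Real.pi : ℂ)))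
  have h3 := (innerSL ℂ v).hasSum h2
  simpa only [spectralOp, ContinuousLinearMap.apply_apply, innerSL_apply_apply,
    smul_apply, inner_smul_right] using h3

@[fun_prop]
lemma continuous_inner_spectralOp (hA : Summable fun h => ‖A h‖) {f g : ℝ → H}
    (hf : Continuous f) (hg : Continuous g) :
    Continuous fun ω => ⟪f ω, spectralOp A ω (g ω)⟫_ℂ :=
  hf.inner ((continuous_spectralOp hA).clm_apply hg)

lemma continuous_excess (hA : Summable fun h => ‖A h‖) {κ : Type*} [Fintype κ]
    {f g : κ → ℝ → H} (hf : ∀ k, Continuous (f k)) (hg : ∀ k, Continuous (g k)) :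
    Continuous fun ω => excess (spectralOp A ω) (fun k => f k ω) (fun k => g k ω) := by
  have h1 : ∀ k k', Continuous fun ω => ⟪f k ω, spectralOp A ω (g k' ω)⟫_ℂ :=
    fun k k' => continuous_inner_spectralOp hA (hf k) (hg k')
  have h2 : ∀ k k', Continuous fun ω => ⟪g k ω, spectralOp A ω (g k' ω)⟫_ℂ :=
    fun k k' => continuous_inner_spectralOp hA (hg k) (hg k')
  unfold excess
  fun_prop

/-- Fourier inversion. -/
lemma integral_char_mul_inner_spectralOp (hA : Summable fun h => ‖A h‖) (l : ℤ) (u v : H) :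
    ∫ ω, char (-l) ω * ⟪v, spectralOp A ω u⟫_ℂ ∂freq = ⟪v, A l u⟫_ℂ := by
  have hb : ∀ h, ‖⟪v, A h u⟫_ℂ‖ ≤ ‖A h‖ * (‖u‖ * ‖v‖) := fun h => by
    calc _ ≤ ‖v‖ * ‖A h u‖ := norm_inner_le_norm _ _
      _ ≤ ‖v‖ * (‖A h‖ * ‖u‖) := by gcongr; exact (A h).le_opNorm u
      _ = _ := by ring
  let f : ℤ → ℝ → ℂ := fun h ω =>
    char (-l) ω * (1 / (2 * (Real.pi : ℂ)) * (char h ω * ⟪v, A h u⟫_ℂ))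
  have hf : ∀ h ω, f h ω = char (h - l) ω * (1 / (2 * (Real.pi : ℂ)) * ⟪v, A h u⟫_ℂ) :=
    fun h ω => by simp only [f]; rw [sub_eq_add_neg, char_add]; ring
  have hint : ∀ h, Integrable (f h) freq := fun h => integrable_freq (by simp only [f]; fun_prop)
  have hsum : Summable fun h => ∫ ω, ‖f h ω‖ ∂freq := by
    simp only [hf, norm_mul, norm_char, one_mul, integral_const]
    refine Summable.mul_left _ (Summable.mul_left _ ?_)
    exact Summable.of_nonneg_of_le (fun _ => norm_nonneg _) hb (hA.mul_right _)
  have h1 := hasSum_integral_of_summable_integral_norm hint hsum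
  have h2 : ∀ ω, ∑' h, f h ω = char (-l) ω * ⟪v, spectralOp A ω u⟫_ℂ := fun ω =>
    ((hasSum_inner_spectralOp hA ω u v).mul_left _).tsum_eq
  simp only [h2] at h1
  refine h1.unique ?_
  have h3 : (fun h => ∫ ω, f h ω ∂freq) = fun h => if h = l then ⟪v, A l u⟫_ℂ else 0 := by
    funext h
    simp only [hf]
    rw [integral_mul_const, integral_char]
    simp only [sub_eq_zero]
    split_ifs with hh
    · subst hh
      have : (Real.pi : ℂ) ≠ 0 := by exact_mod_cast Real.pi_ne_zero
      field_simp
    · simp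
  rw [h3]
  exact hasSum_ite_eq l _

end Trig

/-! ### Finite filter expansions of stationary processes -/

section FilterExpansions

variable {H S Z : Type*} [NormedAddCommGroup H] [InnerProductSpace ℂ H] [CompleteSpace H]
  [NormedAddCommGroup S] [InnerProductSpace ℂ S] [NormedAddCommGroup Z] [InnerProductSpace ℂ Z]

/-- The score `∑_{m ∈ s} ⟨ε_{j-m}, v m⟩`, where `a j u` stands for `⟨ε_j, u⟩`. -/
def scoreSum (a : ℤ → H →L[ℂ] S) (v : ℤ → H) (s : Finset ℤ) (j : ℤ) : S :=
  ∑ m ∈ s, a (j - m) (v m)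

/-- The covariances of the stationary family `a` of random functionals are the operators `A`. -/
structure IsCovariance (a : ℤ → H →L[ℂ] S) (A : ℤ → H →L[ℂ] H) : Prop where
  inner_eq : ∀ j h u v, ⟪a j v, a (j + h) u⟫_ℂ = ⟪v, A h u⟫_ℂ
  summable : Summable fun h => ‖A h‖

variable {a : ℤ → H →L[ℂ] S} {A : ℤ → H →L[ℂ] H}

/-- The covariance of two finite scores, as an integral over frequencies. -/
lemma IsCovariance.inner_scoreSum (h : IsCovariance a A) (v v' : ℤ → H) (s s' : Finset ℤ)
    (j j' : ℤ) : ⟪scoreSum a v' s' j', scoreSum a v s j⟫_ℂ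
      = ∫ ω, char (j' - j) ω * ⟪trig s' v' ω, spectralOp A ω (trig s v ω)⟫_ℂ ∂freq := by
  have hA := h.summable
  have e1 : ∀ ω, char (j' - j) ω * ⟪trig s' v' ω, spectralOp A ω (trig s v ω)⟫_ℂ
      = ∑ m' ∈ s', ∑ m ∈ s,
        char (-((j - m) - (j' - m'))) ω * ⟪v' m', spectralOp A ω (v m)⟫_ℂ := fun ω => by
    rw [inner_trig, Finset.mul_sum]
    refine Finset.sum_congr rfl fun m' _ => ?_
    rw [Finset.mul_sum]
    refine Finset.sum_congr rfl fun m _ => ?_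
    rw [← mul_assoc, ← char_add]
    congr 2; ring
  have hint : ∀ (l : ℤ) (x y : H), Integrable (fun ω => char l ω * ⟪x, spectralOp A ω y⟫_ℂ) freq :=
    fun l x y => integrable_freq ((continuous_char l).mul
      (continuous_inner_spectralOp hA continuous_const continuous_const))
  simp only [e1]
  rw [integral_finsetSum _ fun m' _ => integrable_finsetSum _ fun m _ => hint _ _ _]
  simp only [scoreSum, sum_inner, inner_sum]
  rw [Finset.sum_comm]
  refine Finset.sum_congr rfl fun m' _ => ?_
  rw [integral_finsetSum _ fun m _ => hint _ _ _]
  refine Finset.sum_congr rfl fun m _ => ?_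
  rw [integral_char_mul_inner_spectralOp hA, ← h.inner_eq (j' - m')]
  congr 2; ring_nf

/-- `T` is a tensor product, and `φ` is a family of real filters, relative to the process `e` and
its functionals `a`. Realness enters through the symmetry of the inner product and through
`⟨e_j, φ ⊗ x⟩ = ⟨⟨ε_j, φ⟩, x⟩`. -/
structure IsRealFilter (a : ℤ → H →L[ℂ] S) (e : ℤ → Z) (T : H → S → Z) {κ : Type*}
    (φ : κ → ℤ → H) : Prop where
  inner_comm : ∀ k l k' l', ⟪φ k l, φ k' l'⟫_ℂ = ⟪φ k' l', φ k l⟫_ℂ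
  inner_process : ∀ j k l x, ⟪e j, T (φ k l) x⟫_ℂ = ⟪a j (φ k l), x⟫_ℂ

/-- The reconstruction `∑_{l ∈ s} φ l ⊗ ξ_{j+l}`. -/
def reconSum (T : H → S → Z) (φ : ℤ → H) (ξ : ℤ → S) (s : Finset ℤ) (j : ℤ) : Z :=
  ∑ l ∈ s, T (φ l) (ξ (j + l))

variable {T : H → S → Z} {e : ℤ → Z} {κ : Type*} {φ v : κ → ℤ → H}

lemma IsCovariance.inner_reconSum (h : IsCovariance a A)
    (hT : ∀ u x w y, ⟪T u x, T w y⟫_ℂ = ⟪u, w⟫_ℂ * ⟪x, y⟫_ℂ) (hφ : IsRealFilter a e T φ)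
    (k k' : κ) (s r : Finset ℤ) (j : ℤ) :
    ⟪reconSum T (φ k') (scoreSum a (v k') r) s j, reconSum T (φ k) (scoreSum a (v k) r) s j⟫_ℂ
      = ∫ ω, ⟪trig s (φ k) ω, trig s (φ k') ω⟫_ℂ
          * ⟪trig r (v k') ω, spectralOp A ω (trig r (v k) ω)⟫_ℂ ∂freq := by
  have hA := h.summable
  have hc : Continuous fun ω => ⟪trig r (v k') ω, spectralOp A ω (trig r (v k) ω)⟫_ℂ :=
    continuous_inner_spectralOp hA (by fun_prop) (by fun_prop)
  have e1 : ∀ ω, ⟪trig s (φ k) ω, trig s (φ k') ω⟫_ℂ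
          * ⟪trig r (v k') ω, spectralOp A ω (trig r (v k) ω)⟫_ℂ
      = ∑ l ∈ s, ∑ l' ∈ s, ⟪φ k' l', φ k l⟫_ℂ * (char ((j + l') - (j + l)) ω
          * ⟪trig r (v k') ω, spectralOp A ω (trig r (v k) ω)⟫_ℂ) := fun ω => by
    have := inner_trig s s (φ k') (φ k) (ContinuousLinearMap.id ℂ H) ω
    simp only [ContinuousLinearMap.id_apply] at this
    rw [this, Finset.sum_mul]
    refine Finset.sum_congr rfl fun l _ => ?_
    rw [Finset.sum_mul]
    refine Finset.sum_congr rfl fun l' _ => ?_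
    rw [hφ.inner_comm, add_sub_add_left_eq_sub]; ring
  simp only [e1]
  rw [integral_finsetSum _ fun l _ => integrable_freq (by fun_prop)]
  simp only [reconSum, sum_inner, inner_sum, hT]
  refine Finset.sum_congr rfl fun l _ => ?_
  rw [integral_finsetSum _ fun l' _ => integrable_freq (by fun_prop)]
  refine Finset.sum_congr rfl fun l' _ => ?_
  rw [integral_const_mul, ← h.inner_scoreSum]

lemma IsCovariance.inner_process_reconSum (h : IsCovariance a A) (hφ : IsRealFilter a e T φ)
    (k : κ) (s r : Finset ℤ) (j : ℤ) :
    ⟪e j, reconSum T (φ k) (scoreSum a (v k) r) s j⟫_ℂ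
      = ∫ ω, ⟪trig s (φ k) ω, spectralOp A ω (trig r (v k) ω)⟫_ℂ ∂freq := by
  have hA := h.summable
  have hc : ∀ x : H, Continuous fun ω => ⟪x, spectralOp A ω (trig r (v k) ω)⟫_ℂ :=
    fun x => continuous_inner_spectralOp hA (by fun_prop) (by fun_prop)
  have e1 : ∀ ω, ⟪trig s (φ k) ω, spectralOp A ω (trig r (v k) ω)⟫_ℂ
      = ∑ l ∈ s, char (j - (j + l)) ω * ⟪φ k l, spectralOp A ω (trig r (v k) ω)⟫_ℂ :=
    fun ω => by
      rw [trig, sum_inner]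
      refine Finset.sum_congr rfl fun l _ => ?_
      rw [inner_smul_left, conj_char]
      congr 2; ring
  simp only [e1]
  rw [integral_finsetSum _ fun l _ => integrable_freq (by have := hc (φ k l); fun_prop),
    reconSum, inner_sum]
  refine Finset.sum_congr rfl fun l _ => ?_
  have h1 := h.inner_scoreSum (v k) (fun _ => φ k l) r {0} (j + l) j
  simp only [scoreSum, trig, Finset.sum_singleton, char_zero, one_smul, sub_zero] at h1
  rw [hφ.inner_process]
  exact h1

/-- The mean squared error of a finite filter expansion, relative to that of `0`, as an integral
over frequencies. -/
lemma IsCovariance.norm_sub_reconSum_sq [Fintype κ] (h : IsCovariance a A)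
    (hT : ∀ u x w y, ⟪T u x, T w y⟫_ℂ = ⟪u, w⟫_ℂ * ⟪x, y⟫_ℂ) (hφ : IsRealFilter a e T φ)
    (s r : Finset ℤ) (j : ℤ) :
    ‖e j - ∑ k, reconSum T (φ k) (scoreSum a (v k) r) s j‖ ^ 2 - ‖e j‖ ^ 2
      = ∫ ω, excess (spectralOp A ω) (fun k => trig s (φ k) ω) (fun k => trig r (v k) ω) ∂freq := by
  have hA := h.summable
  have hc1 : ∀ k k', Continuous fun ω => ⟪trig s (φ k) ω, trig s (φ k') ω⟫_ℂ
          * ⟪trig r (v k') ω, spectralOp A ω (trig r (v k) ω)⟫_ℂ := fun k k' => by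
    exact ((continuous_trig _ _).inner (continuous_trig _ _)).mul
      (continuous_inner_spectralOp hA (by fun_prop) (by fun_prop))
  have hc2 : ∀ k, Continuous fun ω => ⟪trig s (φ k) ω, spectralOp A ω (trig r (v k) ω)⟫_ℂ :=
    fun k => continuous_inner_spectralOp hA (by fun_prop) (by fun_prop)
  have i1 := integrable_freq (continuous_finsetSum Finset.univ fun k _ =>
    continuous_finsetSum Finset.univ fun k' _ => hc1 k k')
  have i2 := integrable_freq (continuous_finsetSum Finset.univ fun k _ => hc2 k)
  have j1 := i1.re
  have j2 := i2.re
  have r1 := integral_re i1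
  have r2 := integral_re i2
  simp only [RCLike.re_to_complex] at r1 r2 j1 j2
  simp only [excess]
  rw [integral_sub j1 (j2.const_mul 2), integral_const_mul, r1, r2, norm_sub_sq (𝕜 := ℂ)]
  rw [integral_finsetSum _ fun k _ => integrable_freq (by fun_prop),
    integral_finsetSum _ fun k _ => integrable_freq (hc2 k)]
  have e1 : ((‖∑ k, reconSum T (φ k) (scoreSum a (v k) r) s j‖ ^ 2 : ℝ) : ℂ)
      = ∑ k, ∫ ω, ∑ k', ⟪trig s (φ k) ω, trig s (φ k') ω⟫_ℂ
          * ⟪trig r (v k') ω, spectralOp A ω (trig r (v k) ω)⟫_ℂ ∂freq := by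
    rw [Complex.ofReal_pow, ← Complex.coe_algebraMap]
    erw [← inner_self_eq_norm_sq_to_K (𝕜 := ℂ)]
    simp only [inner_sum, sum_inner]
    refine Finset.sum_congr rfl fun k _ => ?_
    rw [integral_finsetSum _ fun k' _ => integrable_freq (hc1 k k')]
    exact Finset.sum_congr rfl fun k' _ => h.inner_reconSum hT hφ k k' s r j
  have e2 : ⟪e j, ∑ k, reconSum T (φ k) (scoreSum a (v k) r) s j⟫_ℂ
      = ∑ k, ∫ ω, ⟪trig s (φ k) ω, spectralOp A ω (trig r (v k) ω)⟫_ℂ ∂freq := by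
    rw [inner_sum]
    exact Finset.sum_congr rfl fun k _ => h.inner_process_reconSum hφ k s r j
  rw [← e1, ← e2]
  simp only [RCLike.re_to_complex, Complex.ofReal_re]
  ring

end FilterExpansions

/-! ### Limits over windows of lags -/

section Limits

/-- The window of lags `|l| ≤ L`. -/
def window (L : ℕ) : Finset ℤ := Finset.Icc (-(L : ℤ)) (L : ℤ)

lemma symSum_eq {E : Type*} [AddCommMonoid E] (f : ℤ → E) (L : ℕ) :
    symSum f L = ∑ l ∈ window L, f l := rfl

lemma tendsto_window : Tendsto window atTop atTop := by
  refine tendsto_atTop_finset_of_monotone (fun m n h => ?_) fun x => ⟨x.natAbs, ?_⟩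
  · exact Finset.Icc_subset_Icc (by simpa using h) (by simpa using h)
  · simp only [window, Finset.mem_Icc]; omega

lemma summable_of_norm_sum_sq_le {E : Type*} [NormedAddCommGroup E] [CompleteSpace E] {ι : Type*}
    {f : ι → E} {g : ι → ℝ} {C : ℝ} (hg : Summable g)
    (h : ∀ t : Finset ι, ‖∑ i ∈ t, f i‖ ^ 2 ≤ C * ∑ i ∈ t, g i) : Summable f := by
  rw [summable_iff_vanishing_norm]
  intro ε hε
  obtain ⟨s, hs⟩ := summable_iff_vanishing_norm.1 hg (ε ^ 2 / (|C| + 1)) (by positivity)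
  refine ⟨s, fun t ht => ?_⟩
  have h1 := hs t ht
  rw [Real.norm_eq_abs, lt_div_iff₀ (by positivity)] at h1
  have h2 : C * ∑ i ∈ t, g i ≤ |C| * |∑ i ∈ t, g i| := by rw [← abs_mul]; exact le_abs_self _
  have h3 := h t
  refine lt_of_pow_lt_pow_left₀ 2 hε.le ?_
  nlinarith [abs_nonneg (∑ i ∈ t, g i)]

lemma measureReal_freq : freq.real Set.univ = 2 * Real.pi := by
  rw [freq, measureReal_restrict_apply_univ, Real.volume_real_Icc_of_le (by linarith [Real.pi_pos])]
  ring

lemma tendsto_integral_add_sq {x : ℕ → ℝ → ℝ} (hx : ∀ n, MemLp (x n) 2 freq)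
    (hx0 : ∀ n ω, 0 ≤ x n ω) (h : Tendsto (fun n => ∫ ω, x n ω ^ 2 ∂freq) atTop (𝓝 0)) :
    Tendsto (fun n => ∫ ω, (x n ω + x n ω ^ 2) ∂freq) atTop (𝓝 0) := by
  have hi : ∀ n, Integrable (x n) freq := fun n => (hx n).integrable (by norm_num)
  have hi2 : ∀ n, Integrable (fun ω => x n ω ^ 2) freq := fun n => (hx n).integrable_sq
  have hcs : ∀ n, (∫ ω, x n ω ∂freq) ^ 2 ≤ 2 * Real.pi * ∫ ω, x n ω ^ 2 ∂freq := fun n => by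
    have hpi := Real.pi_pos
    -- Cauchy–Schwarz, from the nonnegative variance about the mean `c`
    set c := (∫ ω, x n ω ∂freq) / (2 * Real.pi) with hc
    have h0 : 0 ≤ ∫ ω, (x n ω - c) ^ 2 ∂freq := integral_nonneg fun ω => sq_nonneg _
    have h1 : ∫ ω, (x n ω - c) ^ 2 ∂freq
        = ∫ ω, x n ω ^ 2 ∂freq - 2 * c * ∫ ω, x n ω ∂freq + 2 * Real.pi * c ^ 2 := by
      have : ∀ ω, (x n ω - c) ^ 2 = x n ω ^ 2 - 2 * c * x n ω + c ^ 2 := fun ω => by ring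
      have hi3 : Integrable (fun ω => x n ω ^ 2 - 2 * c * x n ω) freq :=
        (hi2 n).sub ((hi n).const_mul _)
      simp only [this]
      rw [integral_add hi3 (integrable_const _),
        integral_sub (hi2 n) ((hi n).const_mul _), integral_const_mul, integral_const,
        measureReal_freq, smul_eq_mul]
    have h2 : ∫ ω, x n ω ∂freq = 2 * Real.pi * c := by rw [hc]; field_simp
    rw [h1, h2] at h0
    rw [h2]
    nlinarith
  have h1 : Tendsto (fun n => ∫ ω, x n ω ∂freq) atTop (𝓝 0) := by
    have := (h.const_mul (2 * Real.pi)).sqrt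
    simp only [mul_zero, Real.sqrt_zero] at this
    refine squeeze_zero (fun n => integral_nonneg (hx0 n)) (fun n => ?_) this
    exact Real.le_sqrt_of_sq_le (hcs n)
  have := h1.add h
  simp only [add_zero] at this
  exact this.congr fun n => (integral_add (hi n) (hi2 n)).symm

end Limits

/-! ### Unit-norm transfer functions -/

section Transfer

variable {H : Type*} [NormedAddCommGroup H] [InnerProductSpace ℂ H]

/-- `V` is a unit-norm transfer function, whose Fourier coefficients are the filters `v`: the
Fourier series `∑ exp (i l ω) v l` converges to it in `L²`. -/
structure IsTransfer (v : ℤ → H) (V : ℝ → H) : Prop where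
  norm_eq : ∀ᵐ ω ∂freq, ‖V ω‖ = 1
  aestronglyMeasurable : ∀ s, AEStronglyMeasurable (fun ω => ‖trig s v ω - V ω‖) freq
  tendsto : Tendsto (fun L => ∫ ω, ‖trig (window L) v ω - V ω‖ ^ 2 ∂freq) atTop (𝓝 0)
  summable : Summable fun l => ‖v l‖ ^ 2

variable {v : ℤ → H} {V : ℝ → H}

lemma IsTransfer.memLp (h : IsTransfer v V) (s : Finset ℤ) :
    MemLp (fun ω => ‖trig s v ω - V ω‖) 2 freq := by
  refine MemLp.of_bound (h.aestronglyMeasurable s) (∑ l ∈ s, ‖v l‖ + 1) ?_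
  filter_upwards [h.norm_eq] with ω hω
  rw [norm_norm]
  exact (norm_sub_le _ _).trans (by rw [hω]; gcongr; exact norm_trig_le _ _ _)

lemma IsTransfer.tendsto_add_sq (h : IsTransfer v V) :
    Tendsto (fun L => ∫ ω, (‖trig (window L) v ω - V ω‖ + ‖trig (window L) v ω - V ω‖ ^ 2) ∂freq)
      atTop (𝓝 0) :=
  tendsto_integral_add_sq (fun _ => h.memLp _) (fun _ _ => norm_nonneg _) h.tendsto

lemma IsTransfer.integrable_add_sq (h : IsTransfer v V) (s : Finset ℤ) :
    Integrable (fun ω => ‖trig s v ω - V ω‖ + ‖trig s v ω - V ω‖ ^ 2) freq :=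
  ((h.memLp s).integrable (by norm_num)).add (h.memLp s).integrable_sq

end Transfer

/-! ### Continuity of the reconstruction -/

section Tensor

variable {H S Z : Type*} [NormedAddCommGroup H] [InnerProductSpace ℂ H]
  [NormedAddCommGroup S] [InnerProductSpace ℂ S] [NormedAddCommGroup Z] [InnerProductSpace ℂ Z]
  {a : ℤ → H →L[ℂ] S} {T : H → S → Z}

/-- Linearity of `T` in its second argument, as far as it is needed, follows from the formula for
inner products. -/
lemma norm_tensor_sub_sq (hT : ∀ u x w y, ⟪T u x, T w y⟫_ℂ = ⟪u, w⟫_ℂ * ⟪x, y⟫_ℂ) (u : H)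
    (x y : S) : ‖T u x - T u y‖ ^ 2 = ‖u‖ ^ 2 * ‖x - y‖ ^ 2 := by
  have h : ((‖T u x - T u y‖ ^ 2 : ℝ) : ℂ) = ((‖u‖ ^ 2 * ‖x - y‖ ^ 2 : ℝ) : ℂ) := by
    have h1 := inner_self_eq_norm_sq_to_K (𝕜 := ℂ) (T u x - T u y)
    have h2 := inner_self_eq_norm_sq_to_K (𝕜 := ℂ) u
    have h3 := inner_self_eq_norm_sq_to_K (𝕜 := ℂ) (x - y)
    simp only [Complex.coe_algebraMap] at h1 h2 h3
    push_cast
    rw [← h1, ← h2, ← h3]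
    simp only [inner_sub_left, inner_sub_right, hT]
    ring
  exact_mod_cast h

lemma tendsto_tensor (hT : ∀ u x w y, ⟪T u x, T w y⟫_ℂ = ⟪u, w⟫_ℂ * ⟪x, y⟫_ℂ) (u : H)
    {x : ℕ → S} {y : S} (h : Tendsto x atTop (𝓝 y)) :
    Tendsto (fun n => T u (x n)) atTop (𝓝 (T u y)) := by
  rw [tendsto_iff_norm_sub_tendsto_zero] at h ⊢
  have : ∀ n, ‖T u (x n) - T u y‖ = ‖u‖ * ‖x n - y‖ := fun n => by
    rw [← sq_eq_sq₀ (norm_nonneg _) (by positivity), norm_tensor_sub_sq hT]; ring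
  simpa only [this, mul_zero] using h.const_mul ‖u‖

lemma tendsto_reconSum (hT : ∀ u x w y, ⟪T u x, T w y⟫_ℂ = ⟪u, w⟫_ℂ * ⟪x, y⟫_ℂ) {φ v : ℤ → H}
    {ξ : ℤ → S} (hξ : ∀ j, Tendsto (fun M => scoreSum a v (window M) j) atTop (𝓝 (ξ j)))
    (s : Finset ℤ) (j : ℤ) :
    Tendsto (fun M => reconSum T φ (scoreSum a v (window M)) s j) atTop
      (𝓝 (reconSum T φ ξ s j)) :=
  tendsto_finsetSum _ fun _ _ => tendsto_tensor hT _ (hξ _)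

end Tensor

/-! ### Convergence of scores and reconstructions -/

section Convergence

variable {H S Z : Type*} [NormedAddCommGroup H] [InnerProductSpace ℂ H] [CompleteSpace H]
  [NormedAddCommGroup S] [InnerProductSpace ℂ S] [NormedAddCommGroup Z] [InnerProductSpace ℂ Z]
  {a : ℤ → H →L[ℂ] S} {A : ℤ → H →L[ℂ] H} {T : H → S → Z} {e : ℤ → Z}

lemma norm_inner_spectralOp_le (hA : Summable fun h => ‖A h‖) (ω : ℝ) (x y : H) :
    ‖⟪x, spectralOp A ω y⟫_ℂ‖ ≤ (∑' h, ‖A h‖) * (‖x‖ * ‖y‖) := by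
  calc _ ≤ ‖x‖ * ‖spectralOp A ω y‖ := norm_inner_le_norm _ _
    _ ≤ ‖x‖ * ((∑' h, ‖A h‖) * ‖y‖) := by
      gcongr; exact (spectralOp A ω).le_of_opNorm_le (norm_spectralOp_le hA ω) y
    _ = _ := by ring

/-- The score series converges, because the spectral density is bounded. -/
lemma IsCovariance.summable_score [CompleteSpace S] (h : IsCovariance a A) {v : ℤ → H}
    (hv : Summable fun l => ‖v l‖ ^ 2) (j : ℤ) : Summable fun m => a (j - m) (v m) := by
  refine summable_of_norm_sum_sq_le (C := (∑' h, ‖A h‖) * (2 * Real.pi)) hv fun t => ?_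
  have hA := h.summable
  have h1 := h.inner_scoreSum v v t t j j
  simp only [sub_self, char_zero, one_mul] at h1
  have h2 : ‖∑ m ∈ t, a (j - m) (v m)‖ ^ 2 = ‖⟪scoreSum a v t j, scoreSum a v t j⟫_ℂ‖ := by
    rw [inner_self_eq_norm_sq_to_K, norm_pow]; simp [scoreSum]
  rw [h2, h1, mul_assoc, ← integral_norm_trig_sq, ← integral_const_mul]
  refine (norm_integral_le_integral_norm _).trans (integral_mono_of_nonneg
    (ae_of_all _ fun _ => norm_nonneg _) (integrable_freq (by fun_prop)) (ae_of_all _ fun ω => ?_))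
  exact (norm_inner_spectralOp_le hA ω _ _).trans_eq (by ring)

/-- The scores of a unit-norm transfer function have bounded spectral density, so the
reconstruction series converges as soon as the filters are square summable. -/
lemma IsCovariance.summable_recon [CompleteSpace Z] (h : IsCovariance a A)
    (hT : ∀ u x w y, ⟪T u x, T w y⟫_ℂ = ⟪u, w⟫_ℂ * ⟪x, y⟫_ℂ) {v : ℤ → H} {V : ℝ → H}
    (hφ : IsRealFilter a e T fun _ : Unit => v) (hv : IsTransfer v V) {ξ : ℤ → S}
    (hξ : ∀ j, Tendsto (fun M => scoreSum a v (window M) j) atTop (𝓝 (ξ j))) (j : ℤ) :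
    Summable fun l => T (v l) (ξ (j + l)) := by
  refine summable_of_norm_sum_sq_le (C := (∑' h, ‖A h‖) * (2 * Real.pi)) hv.summable fun t => ?_
  have hA := h.summable
  set B := ∑' h, ‖A h‖ with hB
  have hB0 : 0 ≤ B := tsum_nonneg fun _ => norm_nonneg _
  set C := (∑ l ∈ t, ‖v l‖) ^ 2 with hC
  have hlim := ((tendsto_reconSum hT hξ t j (φ := v)).norm.pow 2)
  have hlim2 := ((hv.tendsto_add_sq.const_mul (2 * B * C)).const_add
    (B * (2 * Real.pi) * ∑ l ∈ t, ‖v l‖ ^ 2))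
  rw [mul_zero, add_zero] at hlim2
  refine le_of_tendsto_of_tendsto' hlim hlim2 fun M => ?_
  set x := fun ω => ‖trig (window M) v ω - V ω‖ with hx
  have h1 := h.inner_reconSum hT hφ (v := fun _ => v) () () t (window M) j
  have h2 : ‖reconSum T v (scoreSum a v (window M)) t j‖ ^ 2
      = ‖⟪reconSum T v (scoreSum a v (window M)) t j,
        reconSum T v (scoreSum a v (window M)) t j⟫_ℂ‖ := by
    rw [inner_self_eq_norm_sq_to_K, norm_pow]; simp
  rw [h2, h1, mul_assoc, ← integral_norm_trig_sq, ← integral_const_mul, ← integral_const_mul,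
    ← integral_add ((integrable_freq (by fun_prop)).const_mul _)
      ((hv.integrable_add_sq _).const_mul _)]
  refine (norm_integral_le_integral_norm _).trans (integral_mono_of_nonneg
    (ae_of_all _ fun _ => norm_nonneg _)
    (((integrable_freq (by fun_prop)).const_mul _).add ((hv.integrable_add_sq _).const_mul _)) ?_)
  filter_upwards [hv.norm_eq] with ω hω
  have n1 : ‖⟪trig t v ω, trig t v ω⟫_ℂ‖ = ‖trig t v ω‖ ^ 2 := by
    rw [inner_self_eq_norm_sq_to_K, norm_pow]; simp
  have n2 := norm_inner_spectralOp_le hA ω (trig (window M) v ω) (trig (window M) v ω)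
  have n3 : ‖trig (window M) v ω‖ ≤ 1 + x ω := by
    calc ‖trig (window M) v ω‖ = ‖V ω + (trig (window M) v ω - V ω)‖ := by congr 1; abel
      _ ≤ _ := (norm_add_le _ _).trans (by rw [hω])
  have n4 : ‖trig t v ω‖ ^ 2 ≤ C := by rw [hC]; gcongr; exact norm_trig_le _ _ _
  have hx0 : 0 ≤ x ω := norm_nonneg _
  have n5 : ‖trig (window M) v ω‖ * ‖trig (window M) v ω‖ ≤ 1 + 2 * (x ω + x ω ^ 2) := by
    have := mul_le_mul n3 n3 (norm_nonneg _) (by positivity)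
    nlinarith
  rw [norm_mul, n1]
  calc _ ≤ ‖trig t v ω‖ ^ 2 * (B * (1 + 2 * (x ω + x ω ^ 2))) := by
        gcongr; exact n2.trans (by gcongr)
    _ = B * ‖trig t v ω‖ ^ 2 + 2 * B * ‖trig t v ω‖ ^ 2 * (x ω + x ω ^ 2) := by ring
    _ ≤ B * ‖trig t v ω‖ ^ 2 + 2 * B * C * (x ω + x ω ^ 2) := by gcongr

end Convergence

/-! ### Optimality among filter expansions -/

section Optimality

variable {H S Z : Type*} [NormedAddCommGroup H] [InnerProductSpace ℂ H] [CompleteSpace H]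
  [NormedAddCommGroup S] [InnerProductSpace ℂ S] [NormedAddCommGroup Z] [InnerProductSpace ℂ Z]
  {ι : Type*} [Fintype ι] {a : ι → ℤ → H →L[ℂ] S} {A : ι → ℤ → H →L[ℂ] H} {T : H → S → Z}
  {e : ι → ℤ → Z} {K : ℕ}

lemma sum_norm_sub_reconSum_sq {κ : Type*} [Fintype κ] (h : ∀ i, IsCovariance (a i) (A i))
    (hT : ∀ u x w y, ⟪T u x, T w y⟫_ℂ = ⟪u, w⟫_ℂ * ⟪x, y⟫_ℂ) {φ v : κ → ℤ → H}
    (hφ : ∀ i, IsRealFilter (a i) (e i) T φ) (s r : Finset ℤ) (j : ℤ) :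
    ∑ i, ‖e i j - ∑ k, reconSum T (φ k) (scoreSum (a i) (v k) r) s j‖ ^ 2
      = ∑ i, ‖e i j‖ ^ 2 + ∫ ω, excess (∑ i, spectralOp (A i) ω)
        (fun k => trig s (φ k) ω) (fun k => trig r (v k) ω) ∂freq := by
  simp only [excess_sum]
  rw [integral_finsetSum _ fun i _ => integrable_freq (continuous_excess (h i).summable
    (fun k => by fun_prop) (fun k => by fun_prop)), ← Finset.sum_add_distrib]
  refine Finset.sum_congr rfl fun i _ => ?_
  rw [← (h i).norm_sub_reconSum_sq hT (hφ i)]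
  ring

lemma integrable_excess_sum {κ : Type*} [Fintype κ] (h : ∀ i, IsCovariance (a i) (A i))
    (φ v : κ → ℤ → H) (s r : Finset ℤ) :
    Integrable (fun ω => excess (∑ i, spectralOp (A i) ω)
        (fun k => trig s (φ k) ω) (fun k => trig r (v k) ω)) freq := by
  simp only [excess_sum]
  exact integrable_finsetSum _ fun i _ => integrable_freq (continuous_excess (h i).summable
    (fun k => by fun_prop) (fun k => by fun_prop))

/-- A filter expansion built on the leading eigenvectors of the summed spectral density has
the least mean squared error. Competing expansions enter only through their finite
truncations, whose errors converge to the error of the full expansion. -/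
lemma sum_norm_sub_sq_le (h : ∀ i, IsCovariance (a i) (A i))
    (hT : ∀ u x w y, ⟪T u x, T w y⟫_ℂ = ⟪u, w⟫_ℂ * ⟪x, y⟫_ℂ)
    {η : ℝ → ℕ → ℝ} {b : ℝ → ℕ → H}
    (hexp : ∀ᵐ ω ∂freq, HasWeakExpansion (∑ i, spectralOp (A i) ω) (η ω) (b ω))
    (hb : ∀ᵐ ω ∂freq, Orthonormal ℂ (b ω)) (hη : ∀ᵐ ω ∂freq, ∀ k, 0 ≤ η ω k)
    (hanti : ∀ᵐ ω ∂freq, Antitone (η ω))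
    {c : Fin K → ℝ → ℂ} (hc : ∀ᵐ ω ∂freq, ∀ k, ‖c k ω‖ = 1) {v : Fin K → ℤ → H}
    (hv : ∀ k, IsTransfer (v k) fun ω => c k ω • b ω k)
    (hvr : ∀ i, IsRealFilter (a i) (e i) T v)
    {ξ : ι → Fin K → ℤ → S} {Y : ι → Fin K → Z} {j : ℤ}
    (hξ : ∀ i k m, Tendsto (fun M => scoreSum (a i) (v k) (window M) m) atTop (𝓝 (ξ i k m)))
    (hY : ∀ i k, Tendsto (fun L => reconSum T (v k) (ξ i k) (window L) j) atTop (𝓝 (Y i k)))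
    {φ' v' : Fin K → ℤ → H} (hφ' : ∀ i, IsRealFilter (a i) (e i) T φ')
    {ξ' : ι → Fin K → ℤ → S} {Y' : ι → Fin K → Z}
    (hξ' : ∀ i k m, Tendsto (fun M => scoreSum (a i) (v' k) (window M) m) atTop (𝓝 (ξ' i k m)))
    (hY' : ∀ i k, Tendsto (fun L => reconSum T (φ' k) (ξ' i k) (window L) j) atTop
      (𝓝 (Y' i k))) :
    ∑ i, ‖e i j - ∑ k, Y i k‖ ^ 2 ≤ ∑ i, ‖e i j - ∑ k, Y' i k‖ ^ 2 := by
  set B := ∑ i, ∑' h, ‖A i h‖ with hB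
  have hB0 : 0 ≤ B := Finset.sum_nonneg fun i _ => tsum_nonneg fun _ => norm_nonneg _
  have hFB : ∀ ω, ‖∑ i, spectralOp (A i) ω‖ ≤ B := fun ω =>
    (norm_sum_le _ _).trans (Finset.sum_le_sum fun i _ => norm_spectralOp_le (h i).summable ω)
  set D : ℝ := (2 * Fintype.card (Fin K) + 2) * B with hD
  let x : Fin K → ℕ → ℝ → ℝ := fun k L ω =>
    ‖trig (window L) (v k) ω - c k ω • b ω k‖ + ‖trig (window L) (v k) ω - c k ω • b ω k‖ ^ 2
  have hx : ∀ k L, Integrable (x k L) freq := fun k L => (hv k).integrable_add_sq _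
  have hxlim : Tendsto (fun L => ∑ k, ∫ ω, x k L ω ∂freq) atTop (𝓝 0) := by
    simpa using tendsto_finsetSum Finset.univ fun k (_ : k ∈ Finset.univ) => (hv k).tendsto_add_sq
  -- the optimal expansion, truncated to finitely many lags, against a finite competitor
  have key : ∀ L : ℕ, ∃ C : ℝ, ∀ M L' M' : ℕ,
      ∑ i, ‖e i j - ∑ k, reconSum T (v k) (scoreSum (a i) (v k) (window M)) (window L) j‖ ^ 2
      ≤ ∑ i, ‖e i j
          - ∑ k, reconSum T (φ' k) (scoreSum (a i) (v' k) (window M')) (window L') j‖ ^ 2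
        + D * (C ^ 2 * ∑ k, ∫ ω, x k M ω ∂freq + ∑ k, ∫ ω, x k L ω ∂freq) := by
    intro L
    refine ⟨1 + ∑ k, ∑ l ∈ window L, ‖v k l‖, fun M L' M' => ?_⟩
    set C := 1 + ∑ k, ∑ l ∈ window L, ‖v k l‖ with hC
    have hC1 : 1 ≤ C := le_add_of_nonneg_right (by positivity)
    have hxk : ∀ k, Integrable (fun ω => C ^ 2 * x k M ω + x k L ω) freq := fun k =>
      ((hx k M).const_mul _).add (hx k L)
    have hxi : Integrable (fun ω => D * ∑ k, (C ^ 2 * x k M ω + x k L ω)) freq :=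
      (integrable_finsetSum _ fun k _ => hxk k).const_mul _
    have e1 : D * (C ^ 2 * ∑ k, ∫ ω, x k M ω ∂freq + ∑ k, ∫ ω, x k L ω ∂freq)
        = ∫ ω, D * ∑ k, (C ^ 2 * x k M ω + x k L ω) ∂freq := by
      rw [integral_const_mul, integral_finsetSum _ fun k _ => hxk k]
      congr 1
      rw [Finset.mul_sum, ← Finset.sum_add_distrib]
      refine Finset.sum_congr rfl fun k _ => ?_
      rw [integral_add ((hx k M).const_mul _) (hx k L), integral_const_mul]
    rw [sum_norm_sub_reconSum_sq h hT hvr, sum_norm_sub_reconSum_sq h hT hφ', add_assoc, e1,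
      ← integral_add (integrable_excess_sum h _ _ _ _) hxi]
    gcongr 1
    refine integral_mono_ae (integrable_excess_sum h _ _ _ _)
      ((integrable_excess_sum h _ _ _ _).add hxi) ?_
    filter_upwards [hexp, hb, hη, hanti, hc] with ω h1 h2 h3 h4 h5
    have l1 := h1.neg_sum_le_excess h2 h3 h4 (fun k => trig (window L') (φ' k) ω)
      (fun k => trig (window M') (v' k) ω)
    rw [← h1.excess_eigen h2 (c := fun k => c k ω) h5] at l1
    have l2 := abs_excess_sub_le (hFB ω) hC1 (Φ := fun k => trig (window L) (v k) ω)
      (W := fun k => trig (window M) (v k) ω) (V := fun k => c k ω • b ω k)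
      (fun k => (norm_trig_le _ _ _).trans (le_add_of_nonneg_of_le zero_le_one
        (Finset.single_le_sum (f := fun k => ∑ l ∈ window L, ‖v k l‖)
          (fun _ _ => by positivity) (Finset.mem_univ k))))
      (fun k => by rw [norm_smul, h5, h2.1, one_mul])
    have l3 := (le_abs_self _).trans l2
    simp only [x]
    linarith
  have lim : ∀ (φ v : Fin K → ℤ → H) (ξ : ι → Fin K → ℤ → S),
      (∀ i k m, Tendsto (fun M => scoreSum (a i) (v k) (window M) m) atTop (𝓝 (ξ i k m))) →
      ∀ L, Tendsto (fun M => ∑ i, ‖e i j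
          - ∑ k, reconSum T (φ k) (scoreSum (a i) (v k) (window M)) (window L) j‖ ^ 2) atTop
        (𝓝 (∑ i, ‖e i j - ∑ k, reconSum T (φ k) (ξ i k) (window L) j‖ ^ 2)) :=
    fun φ v ξ hξ L => tendsto_finsetSum _ fun i _ => (((tendsto_finsetSum _ fun k _ =>
      tendsto_reconSum hT (hξ i k) _ j).const_sub _).norm.pow 2)
  have lim' : ∀ (φ : Fin K → ℤ → H) (ξ : ι → Fin K → ℤ → S) (Y : ι → Fin K → Z),
      (∀ i k, Tendsto (fun L => reconSum T (φ k) (ξ i k) (window L) j) atTop (𝓝 (Y i k))) →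
      Tendsto (fun L => ∑ i, ‖e i j - ∑ k, reconSum T (φ k) (ξ i k) (window L) j‖ ^ 2) atTop
        (𝓝 (∑ i, ‖e i j - ∑ k, Y i k‖ ^ 2)) :=
    fun φ ξ Y hY => tendsto_finsetSum _ fun i _ => (((tendsto_finsetSum _ fun k _ =>
      hY i k).const_sub _).norm.pow 2)
  -- the number of lags tends to infinity first in the scores, then in the reconstructions
  refine ge_of_tendsto' (lim' φ' ξ' Y' hY') fun L' => ?_
  refine ge_of_tendsto' (lim φ' v' ξ' hξ' L') fun M' => ?_
  have hright := (hxlim.const_mul D).const_add (∑ i, ‖e i j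
          - ∑ k, reconSum T (φ' k) (scoreSum (a i) (v' k) (window M')) (window L') j‖ ^ 2)
  rw [mul_zero, add_zero] at hright
  refine le_of_tendsto_of_tendsto' (lim' v ξ Y hY) hright fun L => ?_
  obtain ⟨C, hC⟩ := key L
  have hright := (((hxlim.const_mul (C ^ 2)).add_const
    (∑ k, ∫ ω, x k L ω ∂freq)).const_mul D).const_add (∑ i, ‖e i j
          - ∑ k, reconSum T (φ' k) (scoreSum (a i) (v' k) (window M')) (window L') j‖ ^ 2)
  rw [mul_zero, zero_add] at hright
  exact le_of_tendsto_of_tendsto' (lim v v ξ hξ L) hright fun M => hC M L' M'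

end Optimality

/-! ### Square integrable functions on product spaces -/

section SquareIntegrable

variable {α β : Type*} [MeasurableSpace α] [MeasurableSpace β] {μ : Measure α} {ν : Measure β}

lemma eLpNorm_two_sq {E : Type*} [NormedAddCommGroup E] (f : α → E) :
    eLpNorm f 2 μ ^ 2 = ∫⁻ x, ‖f x‖ₑ ^ 2 ∂μ := by
  rw [eLpNorm_eq_lintegral_rpow_enorm_toReal (by norm_num) (by norm_num), ← ENNReal.rpow_two,
    ← ENNReal.rpow_mul]
  simp

lemma ofReal_norm_toLp_sq {E : Type*} [NormedAddCommGroup E] {f : α → E} (hf : MemLp f 2 μ) :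
    ENNReal.ofReal (‖hf.toLp f‖ ^ 2) = ∫⁻ x, ‖f x‖ₑ ^ 2 ∂μ := by
  rw [Lp.norm_toLp, ← ENNReal.toReal_pow, ENNReal.ofReal_toReal
    (ENNReal.pow_ne_top hf.eLpNorm_ne_top), eLpNorm_two_sq]

lemma inner_eq_integral (f g : Lp ℂ 2 μ) : ⟪f, g⟫_ℂ = ∫ x, conj (f x) * g x ∂μ := by
  rw [L2.inner_def]
  exact integral_congr_ae (ae_of_all _ fun x => by simp only [RCLike.inner_apply]; ring)

lemma inner_toLp {f g : α → ℂ} (hf : MemLp f 2 μ) (hg : MemLp g 2 μ) :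
    ⟪hf.toLp f, hg.toLp g⟫_ℂ = ∫ x, conj (f x) * g x ∂μ := by
  rw [inner_eq_integral]
  refine integral_congr_ae ?_
  filter_upwards [hf.coeFn_toLp, hg.coeFn_toLp] with x h1 h2
  rw [h1, h2]

lemma memLp_conj {f : α → ℂ} (hf : MemLp f 2 μ) : MemLp (fun x => conj (f x)) 2 μ := hf.star

lemma enorm_integral_mul_sq_le {f g : α → ℂ} (hf : AEStronglyMeasurable f μ)
    (hg : AEStronglyMeasurable g μ) :
    ‖∫ x, f x * g x ∂μ‖ₑ ^ 2 ≤ (∫⁻ x, ‖f x‖ₑ ^ 2 ∂μ) * ∫⁻ x, ‖g x‖ₑ ^ 2 ∂μ := by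
  have h1 : ‖∫ x, f x * g x ∂μ‖ₑ ≤ ∫⁻ x, ‖f x‖ₑ * ‖g x‖ₑ ∂μ :=
    (enorm_integral_le_lintegral_enorm _).trans_eq (by simp only [enorm_mul])
  have h2 := ENNReal.lintegral_mul_le_Lp_mul_Lq μ Real.HolderConjugate.two_two hf.enorm hg.enorm
  simp only [Pi.mul_apply, ENNReal.rpow_two] at h2
  calc _ ≤ ((∫⁻ x, ‖f x‖ₑ ^ 2 ∂μ) ^ (1 / 2 : ℝ) * (∫⁻ x, ‖g x‖ₑ ^ 2 ∂μ) ^ (1 / 2 : ℝ)) ^ 2 := by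
        gcongr; exact h1.trans h2
    _ = _ := by
        rw [mul_pow, ← ENNReal.rpow_two, ← ENNReal.rpow_two, ← ENNReal.rpow_mul,
          ← ENNReal.rpow_mul]
        norm_num

lemma memLp_two_of_lintegral_lt_top {E : Type*} [NormedAddCommGroup E] {f : α → E}
    (hf : AEStronglyMeasurable f μ)
    (h : ∫⁻ x, ‖f x‖ₑ ^ 2 ∂μ < ⊤) : MemLp f 2 μ := by
  refine ⟨hf, ?_⟩
  rw [← eLpNorm_two_sq] at h
  by_contra hn
  rw [not_lt, top_le_iff] at hn
  simp [hn] at h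

lemma lintegral_enorm_sq_lt_top {E : Type*} [NormedAddCommGroup E] {f : α → E}
    (hf : MemLp f 2 μ) : ∫⁻ x, ‖f x‖ₑ ^ 2 ∂μ < ⊤ := by
  rw [← eLpNorm_two_sq]; exact ENNReal.pow_lt_top hf.2

lemma inner_comm_of_real {u v : Lp ℂ 2 ν} (hu : ∀ᵐ t ∂ν, conj (u t) = u t)
    (hv : ∀ᵐ t ∂ν, conj (v t) = v t) : ⟪u, v⟫_ℂ = ⟪v, u⟫_ℂ := by
  rw [inner_eq_integral, inner_eq_integral]
  refine integral_congr_ae ?_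
  filter_upwards [hu, hv] with t h1 h2
  rw [h1, h2, mul_comm]

lemma integrable_mul_of_memLp {f g : α → ℂ} (hf : MemLp f 2 μ) (hg : MemLp g 2 μ) :
    Integrable (fun x => f x * g x) μ := hf.integrable_mul hg

variable [SFinite ν]

lemma memLp_mul_prod {f : α → ℂ} {g : β → ℂ} (hf : MemLp f 2 μ) (hg : MemLp g 2 ν) :
    MemLp (fun z : α × β => g z.2 * f z.1) 2 (μ.prod ν) := by
  refine memLp_two_of_lintegral_lt_top (hg.1.comp_snd.mul hf.1.comp_fst) ?_
  simp only [enorm_mul, mul_pow, mul_comm (‖g _‖ₑ ^ 2)]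
  rw [lintegral_prod_mul (f := fun x => ‖f x‖ₑ ^ 2) (g := fun x => ‖g x‖ₑ ^ 2)
    (hf.1.enorm.pow_const 2) (hg.1.enorm.pow_const 2)]
  exact ENNReal.mul_lt_top (lintegral_enorm_sq_lt_top hf) (lintegral_enorm_sq_lt_top hg)

lemma lintegral_integral_mul_le {f : α × β → ℂ} (hf : AEStronglyMeasurable f (μ.prod ν))
    {u : β → ℂ} (hu : AEStronglyMeasurable u ν) :
    ∫⁻ w, ‖∫ t, f (w, t) * u t ∂ν‖ₑ ^ 2 ∂μ
      ≤ (∫⁻ z, ‖f z‖ₑ ^ 2 ∂(μ.prod ν)) * ∫⁻ t, ‖u t‖ₑ ^ 2 ∂ν := by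
  have hm : AEMeasurable (fun z => ‖f z‖ₑ ^ 2) (μ.prod ν) := hf.enorm.pow_const 2
  rw [lintegral_prod _ hm, ← lintegral_mul_const'' _ hm.lintegral_prod_right']
  refine lintegral_mono_ae ?_
  filter_upwards [hf.prodMk_left] with w hw
  exact enorm_integral_mul_sq_le hw hu

/-- The tensor product `(w, t) ↦ u t * x w` of square integrable functions. -/
def tensorLp (u : Lp ℂ 2 ν) (x : Lp ℂ 2 μ) : Lp ℂ 2 (μ.prod ν) :=
  (memLp_mul_prod (Lp.memLp x) (Lp.memLp u)).toLp _

lemma tensorLp_toLp {f : α → ℂ} {g : β → ℂ} (hf : MemLp f 2 μ) (hg : MemLp g 2 ν) :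
    tensorLp (hg.toLp g) (hf.toLp f) =ᵐ[μ.prod ν] fun z => g z.2 * f z.1 := by
  filter_upwards [MemLp.coeFn_toLp (memLp_mul_prod (Lp.memLp (hf.toLp f)) (Lp.memLp (hg.toLp g))),
    Measure.quasiMeasurePreserving_fst.ae hf.coeFn_toLp,
    Measure.quasiMeasurePreserving_snd.ae hg.coeFn_toLp] with z h1 h2 h3
  rw [tensorLp, h1, h2, h3]

lemma memLp_integral_mul {f : α × β → ℂ} (hf : MemLp f 2 (μ.prod ν)) {u : β → ℂ}
    (hu : MemLp u 2 ν) : MemLp (fun w => ∫ t, f (w, t) * u t ∂ν) 2 μ :=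
  memLp_two_of_lintegral_lt_top
    (AEStronglyMeasurable.integral_prod_right' (f := fun z : α × β => f z * u z.2)
      (hf.1.mul hu.1.comp_snd))
    ((lintegral_integral_mul_le hf.1 hu.1).trans_lt
      (ENNReal.mul_lt_top (lintegral_enorm_sq_lt_top hf) (lintegral_enorm_sq_lt_top hu)))

variable [SFinite μ]

lemma inner_tensorLp (u : Lp ℂ 2 ν) (x : Lp ℂ 2 μ) (v : Lp ℂ 2 ν) (y : Lp ℂ 2 μ) :
    ⟪tensorLp u x, tensorLp v y⟫_ℂ = ⟪u, v⟫_ℂ * ⟪x, y⟫_ℂ := by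
  rw [tensorLp, tensorLp, inner_toLp, inner_eq_integral, inner_eq_integral, mul_comm,
    ← integral_prod_mul (fun w => conj (x w) * y w) fun t => conj (u t) * v t]
  exact integral_congr_ae (ae_of_all _ fun z => by simp only [map_mul]; ring)

lemma norm_tensorLp (u : Lp ℂ 2 ν) (x : Lp ℂ 2 μ) : ‖tensorLp u x‖ = ‖u‖ * ‖x‖ := by
  have h1 := inner_tensorLp u x u x
  simp only [inner_self_eq_norm_sq_to_K, Complex.coe_algebraMap] at h1
  have h2 : ‖tensorLp u x‖ ^ 2 = (‖u‖ * ‖x‖) ^ 2 := by rw [mul_pow]; exact_mod_cast h1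
  exact (sq_eq_sq₀ (norm_nonneg _) (by positivity)).1 h2

lemma memLp_section {f : α × β → ℂ} (hf : MemLp f 2 (μ.prod ν)) :
    ∀ᵐ w ∂μ, MemLp (fun t => f (w, t)) 2 ν := by
  filter_upwards [hf.1.prodMk_left, (((memLp_two_iff_integrable_sq_norm hf.1).1 hf)).prod_right_ae]
    with w h1 h2
  exact (memLp_two_iff_integrable_sq_norm h1).2 h2

/-- The functional `u ↦ ⟨ε, u⟩ = ∫ conj (ε t) u t` of a random element `ε` with finite second
moment, as an operator into the square integrable random variables. -/
def coefLp {f : α × β → ℂ} (hf : MemLp f 2 (μ.prod ν)) : Lp ℂ 2 ν →L[ℂ] Lp ℂ 2 μ :=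
  LinearMap.mkContinuous
    { toFun := fun u => (memLp_integral_mul (memLp_conj hf) (Lp.memLp u)).toLp _
      map_add' := fun u v => by
        rw [← MemLp.toLp_add, MemLp.toLp_eq_toLp_iff]
        filter_upwards [memLp_section (memLp_conj hf)] with w hw
        rw [Pi.add_apply, ← integral_add (integrable_mul_of_memLp hw (Lp.memLp u))
          (integrable_mul_of_memLp hw (Lp.memLp v))]
        refine integral_congr_ae ?_
        filter_upwards [Lp.coeFn_add u v] with t ht
        rw [ht, Pi.add_apply, mul_add]
      map_smul' := fun c u => by
        rw [RingHom.id_apply, ← MemLp.toLp_const_smul, MemLp.toLp_eq_toLp_iff]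
        refine ae_of_all _ fun w => ?_
        rw [Pi.smul_apply, ← integral_smul]
        refine integral_congr_ae ?_
        filter_upwards [Lp.coeFn_smul c u] with t ht
        rw [ht, Pi.smul_apply, smul_eq_mul, smul_eq_mul]
        ring }
    ‖hf.toLp f‖ fun u => by
      have hu := Lp.memLp u
      have h1 := lintegral_integral_mul_le (memLp_conj hf).1 hu.1
      rw [← ofReal_norm_toLp_sq (memLp_integral_mul (memLp_conj hf) hu),
        ← ofReal_norm_toLp_sq hu, Lp.toLp_coeFn] at h1
      simp only [RCLike.enorm_conj] at h1
      rw [← ofReal_norm_toLp_sq hf, ← ENNReal.ofReal_mul (by positivity),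
        ENNReal.ofReal_le_ofReal_iff (by positivity), ← mul_pow] at h1
      exact (sq_le_sq₀ (norm_nonneg _) (by positivity)).1 h1

lemma coefLp_apply {f : α × β → ℂ} (hf : MemLp f 2 (μ.prod ν)) {u : β → ℂ} (hu : MemLp u 2 ν) :
    coefLp hf (hu.toLp u) = (memLp_integral_mul (memLp_conj hf) hu).toLp _ := by
  change (memLp_integral_mul (memLp_conj hf) (Lp.memLp (hu.toLp u))).toLp _ = _
  rw [MemLp.toLp_eq_toLp_iff]
  refine ae_of_all _ fun w => integral_congr_ae ?_
  filter_upwards [hu.coeFn_toLp] with t ht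
  rw [ht]

lemma coefLp_coeFn {f : α × β → ℂ} (hf : MemLp f 2 (μ.prod ν)) (u : Lp ℂ 2 ν) :
    coefLp hf u =ᵐ[μ] fun w => ∫ t, conj (f (w, t)) * u t ∂ν := by
  have := coefLp_apply hf (Lp.memLp u)
  rw [Lp.toLp_coeFn] at this
  rw [this]
  exact MemLp.coeFn_toLp _

lemma inner_toLp_tensorLp {f : α × β → ℂ} (hf : MemLp f 2 (μ.prod ν))
    (hfr : ∀ z, conj (f z) = f z) {u : Lp ℂ 2 ν} (hu : ∀ᵐ t ∂ν, conj (u t) = u t)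
    (x : Lp ℂ 2 μ) : ⟪hf.toLp f, tensorLp u x⟫_ℂ = ⟪coefLp hf u, x⟫_ℂ := by
  have hm := memLp_mul_prod (Lp.memLp x) (Lp.memLp u)
  rw [tensorLp, inner_toLp, integral_prod _ (integrable_mul_of_memLp (memLp_conj hf) hm),
    inner_eq_integral]
  refine integral_congr_ae ?_
  filter_upwards [coefLp_coeFn hf u] with w hw
  rw [hw, ← integral_conj, ← integral_mul_const]
  refine integral_congr_ae ?_
  filter_upwards [hu] with t ht
  simp only [map_mul, ht, hfr]
  ring

lemma measurePreserving_assoc_symm : MeasurePreserving (fun z : α × β × β => ((z.1, z.2.1), z.2.2))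
    (μ.prod (ν.prod ν)) ((μ.prod ν).prod ν) :=
  (MeasurePreserving.mk MeasurableEquiv.prodAssoc.measurable Measure.prodAssoc_prod).symm
    MeasurableEquiv.prodAssoc

lemma memLp_mul_left_section {f : α × β → ℂ} (hf : MemLp f 2 (μ.prod ν)) {v : β → ℂ}
    (hv : MemLp v 2 ν) :
    MemLp (fun z : α × β × β => v z.2.2 * f (z.1, z.2.1)) 2 (μ.prod (ν.prod ν)) :=
  (memLp_mul_prod hf hv).comp_measurePreserving measurePreserving_assoc_symm

lemma memLp_mul_right_section {f : α × β → ℂ} (hf : MemLp f 2 (μ.prod ν)) {u : β → ℂ}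
    (hu : MemLp u 2 ν) :
    MemLp (fun z : α × β × β => u z.2.1 * f (z.1, z.2.2)) 2 (μ.prod (ν.prod ν)) :=
  (memLp_mul_left_section hf hu).comp_measurePreserving
    ((MeasurePreserving.id μ).prod Measure.measurePreserving_swap)

/-- The test kernel `(t, s) ↦ conj (u t) * v s`, which pairs with a covariance kernel to the
covariance of the coefficients of `u` and `v`. -/
def testKernel (u v : Lp ℂ 2 ν) : Lp ℂ 2 (ν.prod ν) := tensorLp v (star u)

lemma testKernel_coeFn (u v : Lp ℂ 2 ν) :
    testKernel u v =ᵐ[ν.prod ν] fun z => v z.2 * conj (u z.1) := by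
  filter_upwards [MemLp.coeFn_toLp (memLp_mul_prod (Lp.memLp (star u)) (Lp.memLp v)),
    Measure.quasiMeasurePreserving_fst.ae (Lp.coeFn_star u)] with z h1 h2
  rw [testKernel, tensorLp, h1, h2]; rfl

lemma norm_testKernel (u v : Lp ℂ 2 ν) : ‖testKernel u v‖ = ‖v‖ * ‖u‖ := by
  have : ‖star u‖ = ‖u‖ := by
    rw [Lp.norm_def, Lp.norm_def, eLpNorm_congr_ae (Lp.coeFn_star u)]
    congr 1
    exact eLpNorm_congr_norm_ae (ae_of_all _ fun t => norm_star _)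
  rw [testKernel, norm_tensorLp, this]

lemma inner_testKernel (u v : Lp ℂ 2 ν) {C : β × β → ℂ} (hC : MemLp C 2 (ν.prod ν)) :
    ⟪testKernel u v, hC.toLp C⟫_ℂ = ∫ z, C z * (u z.1 * conj (v z.2)) ∂(ν.prod ν) := by
  rw [inner_eq_integral]
  refine integral_congr_ae ?_
  filter_upwards [testKernel_coeFn u v, hC.coeFn_toLp] with z h1 h2
  rw [h1, h2]
  simp only [map_mul, Complex.conj_conj]
  ring

/-- The covariance of two coefficients, through the covariance kernel. -/
lemma inner_coefLp {f g : α × β → ℂ} (hf : MemLp f 2 (μ.prod ν)) (hg : MemLp g 2 (μ.prod ν))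
    (u v : Lp ℂ 2 ν) {C : β × β → ℂ} (hC : MemLp C 2 (ν.prod ν))
    (hCe : ∀ᵐ z ∂(ν.prod ν), ∫ w, conj (f (w, z.1)) * g (w, z.2) ∂μ = C z) :
    ⟪coefLp hg v, coefLp hf u⟫_ℂ = ⟪testKernel u v, hC.toLp C⟫_ℂ := by
  let G : α → β × β → ℂ := fun w z =>
    conj (f (w, z.1)) * u z.1 * (g (w, z.2) * conj (v z.2))
  have hG : Integrable (Function.uncurry G) (μ.prod (ν.prod ν)) := by
    have := (memLp_mul_left_section (memLp_conj hf) (memLp_conj (Lp.memLp v))).integrable_mul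
      (memLp_mul_right_section hg (Lp.memLp u))
    refine this.congr (ae_of_all _ fun z => ?_)
    simp only [G, Function.uncurry, Pi.mul_apply]
    ring
  rw [inner_testKernel, inner_eq_integral]
  calc ∫ w, conj (coefLp hg v w) * coefLp hf u w ∂μ = ∫ w, ∫ z, G w z ∂(ν.prod ν) ∂μ := by
        refine integral_congr_ae ?_
        filter_upwards [coefLp_coeFn hg v, coefLp_coeFn hf u] with w h1 h2
        rw [h1, h2, ← integral_conj, mul_comm]
        simp only [G]
        rw [integral_prod_mul (fun t => conj (f (w, t)) * u t) fun s => g (w, s) * conj (v s)]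
        simp only [map_mul, Complex.conj_conj]
    _ = ∫ z, ∫ w, G w z ∂μ ∂(ν.prod ν) := integral_integral_swap hG
    _ = _ := by
        refine integral_congr_ae ?_
        filter_upwards [hCe] with z hz
        rw [← hz, ← integral_mul_const]
        refine integral_congr_ae (ae_of_all _ fun w => ?_)
        simp only [G]
        ring

lemma aestronglyMeasurable_integral_mul {f g : α × β → ℂ} (hf : MemLp f 2 (μ.prod ν))
    (hg : MemLp g 2 (μ.prod ν)) [IsFiniteMeasure ν] :
    AEStronglyMeasurable (fun z : β × β => ∫ w, f (w, z.1) * g (w, z.2) ∂μ) (ν.prod ν) := by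
  have h1 := (memLp_mul_left_section hf (memLp_const (1 : ℂ))).1
  have h2 := (memLp_mul_right_section hg (memLp_const (1 : ℂ))).1
  simp only [one_mul] at h1 h2
  exact (AEStronglyMeasurable.prod_swap (h1.mul h2)).integral_prod_right'

end SquareIntegrable

/-! ### Fourier coefficients of vector-valued functions -/

section Fourier

variable {β : Type*}

/-- The filters `t ↦ (1/2π) ∫ G(ω, t) exp (-i l ω) dω` of the transfer function `G`. -/
def fourierFilter (G : ℝ × β → ℂ) (l : ℤ) (t : β) : ℂ :=
  1 / (2 * (Real.pi : ℂ)) * ∫ ω, G (ω, t) * Complex.exp (-(Complex.I * l * ω)) ∂freq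

lemma fourierFilter_eq (G : ℝ × β → ℂ) (l : ℤ) (t : β) :
    fourierFilter G l t = 1 / (2 * (Real.pi : ℂ)) * ∫ ω, G (ω, t) * char (-l) ω ∂freq := by
  simp only [fourierFilter, char]
  push_cast
  simp only [mul_neg, neg_mul]

lemma two_pi_mul_fourierFilter (G : ℝ × β → ℂ) (l : ℤ) (t : β) :
    ∫ ω, G (ω, t) * char (-l) ω ∂freq = 2 * Real.pi * fourierFilter G l t := by
  have : (Real.pi : ℂ) ≠ 0 := by exact_mod_cast Real.pi_ne_zero
  rw [fourierFilter_eq]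
  field_simp

variable [MeasurableSpace β] {ν : Measure β} {G : ℝ × β → ℂ}

lemma memLp_char (l : ℤ) : MemLp (char l) 2 freq :=
  MemLp.of_bound (continuous_char l).aestronglyMeasurable 1 (ae_of_all _ fun ω => (norm_char l ω).le)

/-- Parseval's identity over `[-π, π]`. -/
lemma hasSum_norm_integral_char_sq {f : ℝ → ℂ} (hf : MemLp f 2 freq) :
    HasSum (fun l : ℤ => ‖1 / (2 * (Real.pi : ℂ)) * ∫ ω, f ω * char (-l) ω ∂freq‖ ^ 2)
      ((2 * Real.pi)⁻¹ * ∫ ω, ‖f ω‖ ^ 2 ∂freq) := by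
  have hpi := Real.pi_pos
  have hab : -Real.pi < Real.pi := by linarith
  have hfr : freq = volume.restrict (Set.Ioc (-Real.pi) Real.pi) :=
    (Measure.restrict_congr_set Ioc_ae_eq_Icc).symm
  have h := hasSum_sq_fourierCoeffOn hab (hfr ▸ hf)
  have e1 : (Real.pi - -Real.pi)⁻¹ • ∫ x in (-Real.pi)..Real.pi, ‖f x‖ ^ 2
      = (2 * Real.pi)⁻¹ * ∫ ω, ‖f ω‖ ^ 2 ∂freq := by
    rw [hfr, intervalIntegral.integral_of_le hab.le, smul_eq_mul]
    ring_nf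
  rw [e1] at h
  refine h.congr_fun fun l => ?_
  rw [fourierCoeffOn_eq_integral, integral_freq]
  congr 2
  rw [Complex.real_smul]
  congr 1
  · push_cast; ring
  · refine intervalIntegral.integral_congr fun x _ => ?_
    have hpi' : (Real.pi : ℂ) ≠ 0 := by exact_mod_cast Real.pi_ne_zero
    simp only [fourier_coe_apply, smul_eq_mul, char]
    rw [mul_comm]
    congr 2
    push_cast
    field_simp
    ring

variable [IsFiniteMeasure ν]

lemma memLp_fourierFilter (hG : MemLp G 2 (freq.prod ν)) (l : ℤ) :
    MemLp (fourierFilter G l) 2 ν := by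
  have h1 : MemLp (fun z : β × ℝ => G z.swap) 2 (ν.prod freq) :=
    hG.comp_measurePreserving Measure.measurePreserving_swap
  have h2 := (memLp_integral_mul h1 (memLp_char (-l))).const_mul (1 / (2 * (Real.pi : ℂ)))
  convert h2 using 1
  funext t
  exact fourierFilter_eq G l t

/-- The filters as elements of `L²`. -/
def filterLp (hG : MemLp G 2 (freq.prod ν)) (l : ℤ) : Lp ℂ 2 ν := (memLp_fourierFilter hG l).toLp _

lemma inner_tensorLp_char (hG : MemLp G 2 (freq.prod ν)) (l : ℤ) :
    ⟪tensorLp (filterLp hG l) ((memLp_char l).toLp _), hG.toLp G⟫_ℂ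
      = ((2 * Real.pi * ‖filterLp hG l‖ ^ 2 : ℝ) : ℂ) := by
  have hm := memLp_mul_prod (memLp_char l) (memLp_fourierFilter hG l)
  have h1 : tensorLp (filterLp hG l) ((memLp_char l).toLp _) = hm.toLp _ := by
    refine Lp.ext ?_
    filter_upwards [tensorLp_toLp (memLp_char l) (memLp_fourierFilter hG l), hm.coeFn_toLp]
      with z h1 h2
    rw [filterLp, h1, h2]
  have h2 : ((‖filterLp hG l‖ ^ 2 : ℝ) : ℂ)
      = ∫ t, conj (fourierFilter G l t) * fourierFilter G l t ∂ν := by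
    rw [← inner_toLp (memLp_fourierFilter hG l) (memLp_fourierFilter hG l)]
    have := inner_self_eq_norm_sq_to_K (𝕜 := ℂ) (filterLp hG l)
    rw [filterLp] at this
    rw [this]
    simp [filterLp]
  rw [h1, inner_toLp, integral_prod_symm _ (integrable_mul_of_memLp (memLp_conj hm) hG),
    Complex.ofReal_mul, h2, ← integral_const_mul]
  refine integral_congr_ae (ae_of_all _ fun t => ?_)
  have : ∀ ω, conj (fourierFilter G l t * char l ω) * G (ω, t)
      = conj (fourierFilter G l t) * (G (ω, t) * char (-l) ω) := fun ω => by
    rw [map_mul, conj_char]; ring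
  simp only [this]
  rw [integral_const_mul, two_pi_mul_fourierFilter]
  push_cast
  ring

lemma inner_char_toLp (l m : ℤ) : ⟪(memLp_char l).toLp _, (memLp_char m).toLp _⟫_ℂ
    = if m = l then 2 * (Real.pi : ℂ) else 0 := by
  rw [inner_toLp]
  simp only [conj_char, ← char_add]
  rw [integral_char]
  simp only [neg_add_eq_zero, eq_comm]

/-- The error of a Fourier partial sum, by orthogonality. -/
lemma norm_sub_sum_tensorLp_sq (hG : MemLp G 2 (freq.prod ν)) (s : Finset ℤ) :
    ‖hG.toLp G - ∑ l ∈ s, tensorLp (filterLp hG l) ((memLp_char l).toLp _)‖ ^ 2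
      = ‖hG.toLp G‖ ^ 2 - ∑ l ∈ s, 2 * Real.pi * ‖filterLp hG l‖ ^ 2 := by
  set f := fun l => tensorLp (filterLp hG l) ((memLp_char l).toLp (char l)) with hf
  have h1 : ⟪∑ l ∈ s, f l, hG.toLp G⟫_ℂ
      = ((∑ l ∈ s, 2 * Real.pi * ‖filterLp hG l‖ ^ 2 : ℝ) : ℂ) := by
    rw [sum_inner, Complex.ofReal_sum]
    exact Finset.sum_congr rfl fun l _ => inner_tensorLp_char hG l
  have h2 : ⟪∑ l ∈ s, f l, ∑ l ∈ s, f l⟫_ℂ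
      = ((∑ l ∈ s, 2 * Real.pi * ‖filterLp hG l‖ ^ 2 : ℝ) : ℂ) := by
    rw [sum_inner, Complex.ofReal_sum]
    refine Finset.sum_congr rfl fun l hl => ?_
    rw [inner_sum, Finset.sum_eq_single_of_mem l hl]
    · rw [hf, inner_tensorLp, inner_char_toLp, if_pos rfl, inner_self_eq_norm_sq_to_K]
      simp only [Complex.coe_algebraMap]
      push_cast
      ring
    · intro m _ hm
      rw [hf, inner_tensorLp, inner_char_toLp, if_neg hm, mul_zero]
  rw [norm_sub_sq (𝕜 := ℂ), ← inner_re_symm, h1,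
    ← inner_self_eq_norm_sq (𝕜 := ℂ) (∑ l ∈ s, f l), h2]
  simp only [RCLike.re_to_complex, Complex.ofReal_re]
  ring

lemma summable_norm_filterLp_sq (hG : MemLp G 2 (freq.prod ν)) :
    Summable fun l => ‖filterLp hG l‖ ^ 2 := by
  have hpi := Real.pi_pos
  have h : Summable fun l => 2 * Real.pi * ‖filterLp hG l‖ ^ 2 := by
    refine summable_of_sum_le (fun l => by positivity) (c := ‖hG.toLp G‖ ^ 2) fun s => ?_
    have := norm_sub_sum_tensorLp_sq hG s
    nlinarith [sq_nonneg ‖hG.toLp G - ∑ l ∈ s, tensorLp (filterLp hG l) ((memLp_char l).toLp _)‖]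
  exact (summable_mul_left_iff (by positivity)).1 h

lemma norm_toLp_sq {α : Type*} [MeasurableSpace α] {μ : Measure α} {f : α → ℂ}
    (hf : MemLp f 2 μ) : ‖hf.toLp f‖ ^ 2 = ∫ x, ‖f x‖ ^ 2 ∂μ := by
  have h := inner_toLp hf hf
  rw [inner_self_eq_norm_sq_to_K] at h
  have : ∀ x, conj (f x) * f x = ((‖f x‖ ^ 2 : ℝ) : ℂ) := fun x => by
    rw [mul_comm, Complex.mul_conj, Complex.normSq_eq_norm_sq]
  simp only [this] at h
  rw [integral_complex_ofReal] at h
  have h' : ((‖hf.toLp f‖ : ℝ) : ℂ) ^ 2 = ((∫ x, ‖f x‖ ^ 2 ∂μ : ℝ) : ℂ) := h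
  exact_mod_cast h'

/-- Parseval's identity for vector-valued transfer functions. -/
lemma hasSum_norm_filterLp_sq (hG : MemLp G 2 (freq.prod ν)) :
    HasSum (fun l => 2 * Real.pi * ‖filterLp hG l‖ ^ 2) (‖hG.toLp G‖ ^ 2) := by
  have hpi := Real.pi_pos
  have h1 : ∀ l, Integrable (fun t => ‖fourierFilter G l t‖ ^ 2) ν := fun l =>
    (memLp_two_iff_integrable_sq_norm (memLp_fourierFilter hG l).1).1 (memLp_fourierFilter hG l)
  have h2 : ∀ l, ‖filterLp hG l‖ ^ 2 = ∫ t, ‖fourierFilter G l t‖ ^ 2 ∂ν := fun l =>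
    norm_toLp_sq _
  have h3 := hasSum_integral_of_summable_integral_norm h1 (by
    simpa only [norm_pow, norm_norm, ← h2] using summable_norm_filterLp_sq hG)
  have h4 : ∫ t, ∑' l, ‖fourierFilter G l t‖ ^ 2 ∂ν = (2 * Real.pi)⁻¹ * ‖hG.toLp G‖ ^ 2 := by
    rw [norm_toLp_sq, integral_prod_symm _ ((memLp_two_iff_integrable_sq_norm hG.1).1 hG),
      ← integral_const_mul]
    refine integral_congr_ae ?_
    have hs : MemLp (fun z : β × ℝ => G z.swap) 2 (ν.prod freq) :=
      hG.comp_measurePreserving Measure.measurePreserving_swap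
    filter_upwards [memLp_section hs] with t ht
    have := hasSum_norm_integral_char_sq (f := fun ω => G (ω, t)) ht
    rw [← this.tsum_eq]
    simp only [fourierFilter_eq]
  rw [h4] at h3
  have h5 := h3.mul_left (2 * Real.pi)
  rw [← mul_assoc, mul_inv_cancel₀ (by positivity), one_mul] at h5
  simpa only [h2] using h5

lemma tendsto_norm_sub_sum_tensorLp_sq (hG : MemLp G 2 (freq.prod ν)) :
    Tendsto (fun L => ‖hG.toLp G
      - ∑ l ∈ window L, tensorLp (filterLp hG l) ((memLp_char l).toLp _)‖ ^ 2) atTop (𝓝 0) := by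
  simp only [norm_sub_sum_tensorLp_sq]
  have := ((hasSum_norm_filterLp_sq hG).comp tendsto_window).const_sub (‖hG.toLp G‖ ^ 2)
  rw [sub_self] at this
  exact this

lemma sum_coeFn_ae {α ι : Type*} [MeasurableSpace α] {μ : Measure α} (s : Finset ι)
    (f : ι → Lp ℂ 2 μ) : ⇑(∑ i ∈ s, f i) =ᵐ[μ] fun x => ∑ i ∈ s, f i x :=
  Lp.coeFn_fun_finsetSum s f

/-- A measurable transfer function with unit-norm fibres `V`. -/
lemma isTransfer_filterLp (hG : MemLp G 2 (freq.prod ν)) {V : ℝ → Lp ℂ 2 ν}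
    (hV : ∀ᵐ ω ∂freq, V ω =ᵐ[ν] fun t => G (ω, t)) (hV1 : ∀ᵐ ω ∂freq, ‖V ω‖ = 1) :
    IsTransfer (filterLp hG) V := by
  let D : Finset ℤ → ℝ × β → ℂ := fun s z => ∑ l ∈ s, fourierFilter G l z.2 * char l z.1 - G z
  have hD : ∀ s, MemLp (D s) 2 (freq.prod ν) := fun s =>
    (memLp_finsetSum s fun l _ => memLp_mul_prod (memLp_char l) (memLp_fourierFilter hG l)).sub hG
  have hDn : ∀ s, ‖(hD s).toLp (D s)‖
      = ‖hG.toLp G - ∑ l ∈ s, tensorLp (filterLp hG l) ((memLp_char l).toLp _)‖ := fun s => by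
    rw [norm_sub_rev]
    congr 1
    refine Lp.ext ?_
    have h2 : ∀ᵐ z ∂(freq.prod ν), ∀ l, tensorLp (filterLp hG l) ((memLp_char l).toLp _) z
        = fourierFilter G l z.2 * char l z.1 := by
      rw [ae_all_iff]
      exact fun l => tensorLp_toLp (memLp_char l) (memLp_fourierFilter hG l)
    filter_upwards [(hD s).coeFn_toLp, Lp.coeFn_sub (∑ l ∈ s, tensorLp (filterLp hG l)
      ((memLp_char l).toLp _)) (hG.toLp G), hG.coeFn_toLp, sum_coeFn_ae s fun l =>
      tensorLp (filterLp hG l) ((memLp_char l).toLp _), h2] with z h1 h3 h4 h5 h6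
    rw [h1, h3, Pi.sub_apply, h4, h5, Finset.sum_congr rfl fun l _ => h6 l]
  have hi : ∀ s, Integrable (fun z => ‖D s z‖ ^ 2) (freq.prod ν) := fun s =>
    (memLp_two_iff_integrable_sq_norm (hD s).1).1 (hD s)
  have hfib : ∀ s, ∀ᵐ ω ∂freq, ‖trig s (filterLp hG) ω - V ω‖ ^ 2 = ∫ t, ‖D s (ω, t)‖ ^ 2 ∂ν := by
    intro s
    filter_upwards [hV, memLp_section (hD s)] with ω h1 h2
    have : trig s (filterLp hG) ω - V ω = h2.toLp _ := by
      refine Lp.ext ?_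
      have h6 : ∀ᵐ t ∂ν, ∀ l, (char l ω • filterLp hG l : Lp ℂ 2 ν) t
          = fourierFilter G l t * char l ω := by
        rw [ae_all_iff]
        intro l
        filter_upwards [Lp.coeFn_smul (char l ω) (filterLp hG l),
          (memLp_fourierFilter hG l).coeFn_toLp] with t h3 h4
        rw [h3, Pi.smul_apply, smul_eq_mul, mul_comm, filterLp, h4]
      filter_upwards [Lp.coeFn_sub (trig s (filterLp hG) ω) (V ω), h1, h2.coeFn_toLp,
        sum_coeFn_ae s fun l => char l ω • filterLp hG l, h6] with t h3 h4 h5 h7 h8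
      rw [h3, h5, Pi.sub_apply, h4, trig, h7, Finset.sum_congr rfl fun l _ => h8 l]
    rw [this, norm_toLp_sq]
  refine ⟨hV1, fun s => ?_, ?_, summable_norm_filterLp_sq hG⟩
  · have h1 : AEStronglyMeasurable (fun ω => √(∫ t, ‖D s (ω, t)‖ ^ 2 ∂ν)) freq :=
      Real.continuous_sqrt.comp_aestronglyMeasurable (hi s).1.integral_prod_right'
    refine h1.congr ?_
    filter_upwards [hfib s] with ω hω
    rw [← hω, Real.sqrt_sq (norm_nonneg _)]
  · refine (tendsto_norm_sub_sum_tensorLp_sq hG).congr fun L => ?_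
    rw [← hDn, norm_toLp_sq, integral_prod _ (hi _)]
    exact integral_congr_ae ((hfib _).mono fun ω hω => hω.symm)

lemma map_neg_freq : MeasurePreserving (fun ω : ℝ => -ω) freq freq := by
  have h := (Measure.measurePreserving_neg (volume : Measure ℝ)).restrict_preimage
    (s := Set.Icc (-Real.pi) Real.pi) measurableSet_Icc
  have e : (fun ω : ℝ => -ω) ⁻¹' Set.Icc (-Real.pi) Real.pi = Set.Icc (-Real.pi) Real.pi := by
    ext ω; simp only [Set.mem_preimage, Set.mem_Icc]; constructor <;> rintro ⟨h1, h2⟩ <;>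
      constructor <;> linarith
  have h' : MeasurePreserving (fun ω : ℝ => -ω)
    (volume.restrict ((fun ω : ℝ => -ω) ⁻¹' Set.Icc (-Real.pi) Real.pi))
    (volume.restrict (Set.Icc (-Real.pi) Real.pi)) := h
  rwa [e] at h'

/-- A transfer function with `G(-ω, t) = conj (G(ω, t))` has real filters. -/
lemma conj_fourierFilter (hG : AEStronglyMeasurable G (freq.prod ν))
    (hsymm : ∀ᵐ ω ∂freq, ∀ᵐ t ∂ν, G (-ω, t) = conj (G (ω, t))) (l : ℤ) :
    ∀ᵐ t ∂ν, conj (fourierFilter G l t) = fourierFilter G l t := by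
  have hG' : AEStronglyMeasurable (fun z : ℝ × β => G (-z.1, z.2)) (freq.prod ν) :=
    hG.comp_measurePreserving (map_neg_freq.prod (MeasurePreserving.id ν))
  have hm : AEMeasurable (fun z : ℝ × β => ‖G (-z.1, z.2) - conj (G z)‖ₑ) (freq.prod ν) :=
    (hG'.sub (Complex.continuous_conj.comp_aestronglyMeasurable hG)).enorm
  have h0 : ∫⁻ z, ‖G (-z.1, z.2) - conj (G z)‖ₑ ∂(freq.prod ν) = 0 := by
    rw [lintegral_prod _ hm, ← lintegral_zero (μ := freq)]
    refine lintegral_congr_ae ?_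
    filter_upwards [hsymm] with ω hω
    rw [← lintegral_zero (μ := ν)]
    refine lintegral_congr_ae ?_
    filter_upwards [hω] with t ht
    simp [ht]
  have hm' : AEMeasurable (fun z : β × ℝ => ‖G (-z.2, z.1) - conj (G (z.2, z.1))‖ₑ)
    (ν.prod freq) := hm.prod_swap
  rw [lintegral_prod_symm _ hm] at h0
  have h0' : ∀ᵐ z ∂(ν.prod freq), ‖G (-z.2, z.1) - conj (G (z.2, z.1))‖ₑ = 0 :=
    (lintegral_eq_zero_iff' hm').1 (by rw [lintegral_prod _ hm']; exact h0)
  filter_upwards [Measure.ae_ae_of_ae_prod h0'] with t ht'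
  rw [fourierFilter_eq, map_mul, ← integral_conj]
  congr 1
  · simp [map_ofNat]
  · rw [← map_neg_freq.integral_comp (MeasurableEquiv.neg ℝ).measurableEmbedding
      fun ω => G (ω, t) * char (-l) ω]
    refine integral_congr_ae ?_
    filter_upwards [ht'] with ω hω
    have h1 : G (-ω, t) = conj (G (ω, t)) := by
      simpa [sub_eq_zero] using hω
    rw [map_mul, conj_char, h1]
    congr 1
    simp [char]

end Fourier

/-! ### Mean-square limits -/

section MeanSquareLimit

variable {α : Type*} [MeasurableSpace α] {μ : Measure α} {S : ℕ → α → ℂ} {F : ℕ → Lp ℂ 2 μ}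

lemma IsMSLimit.of_tendsto (hF : ∀ L, F L =ᵐ[μ] S L) {y : Lp ℂ 2 μ}
    (h : Tendsto F atTop (𝓝 y)) : IsMSLimit μ S y := by
  refine ⟨Lp.memLp y, ?_⟩
  rw [Lp.tendsto_Lp_iff_tendsto_eLpNorm'] at h
  refine h.congr fun L => eLpNorm_congr_ae ?_
  filter_upwards [hF L] with x hx
  rw [Pi.sub_apply, hx]

lemma IsMSLimit.tendsto_toLp (hF : ∀ L, F L =ᵐ[μ] S L) {Y : α → ℂ} (h : IsMSLimit μ S Y) :
    Tendsto F atTop (𝓝 (h.1.toLp Y)) := by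
  rw [Lp.tendsto_Lp_iff_tendsto_eLpNorm']
  refine h.2.congr fun L => eLpNorm_congr_ae ?_
  filter_upwards [hF L, h.1.coeFn_toLp] with x h1 h2
  rw [Pi.sub_apply, h1, h2]

end MeanSquareLimit

/-! ### Second-order structure of the series -/

section Series

lemma eLpNorm_ofReal {α : Type*} [MeasurableSpace α] {μ : Measure α} (f : α → ℝ) :
    eLpNorm (fun z => (f z : ℂ)) 2 μ = eLpNorm f 2 μ :=
  eLpNorm_congr_norm_ae (ae_of_all _ fun z => by simp)

variable {Ω : Type*} [MeasurableSpace Ω] {P : Measure Ω} {p : ℕ}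
  {X : Fin p → ℤ → Ω → unitInterval → ℝ}

/-- The centred series as a complex-valued function on `Ω × [0,1]`. -/
def centredFun (P : Measure Ω) (X : Fin p → ℤ → Ω → unitInterval → ℝ) (i : Fin p) (j : ℤ)
    (z : Ω × unitInterval) : ℂ := (centred P X i j z.1 z.2 : ℂ)

lemma conj_centredFun (i : Fin p) (j : ℤ) (z : Ω × unitInterval) :
    conj (centredFun P X i j z) = centredFun P X i j z := Complex.conj_ofReal _

lemma SummableAutocov.tsum_ne_top (hsum : SummableAutocov P X) (i : Fin p) :
    ∑' h : ℤ, eLpNorm (fun z : unitInterval × unitInterval => autocov P X i i h z.1 z.2) 2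
      ((volume : Measure unitInterval).prod (volume : Measure unitInterval)) ≠ ⊤ := by
  refine ne_top_of_le_ne_top hsum.ne ?_
  exact le_iSup_of_le i (le_iSup_of_le i le_rfl)

lemma WeaklyStationary.integral_centredFun_mul (hX : WeaklyStationary P X) (i : Fin p) (j h : ℤ) :
    ∀ᵐ z ∂((volume : Measure unitInterval).prod (volume : Measure unitInterval)),
      ∫ w, conj (centredFun P X i (j + h) (w, z.1)) * centredFun P X i j (w, z.2) ∂P
        = (autocov P X i i h z.1 z.2 : ℂ) := by
  filter_upwards [hX.cov_eq i i j h,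
    Measure.quasiMeasurePreserving_fst.ae (hX.mean_eq i (j + h)),
    Measure.quasiMeasurePreserving_snd.ae (hX.mean_eq i j)] with z h1 h2 h3
  rw [← h1, covariance, ← integral_complex_ofReal]
  refine integral_congr_ae (ae_of_all _ fun w => ?_)
  simp only [conj_centredFun]
  simp only [centredFun, centred, h2, h3]
  push_cast
  rfl

variable [IsProbabilityMeasure P]

lemma WeaklyStationary.memLp_mean (hX : WeaklyStationary P X) (i : Fin p) :
    MemLp (fun t => (mean P X i t : ℂ)) 2 (volume : Measure unitInterval) := by
  have h1 : MemLp (fun z : unitInterval × Ω => ((X i 0 z.2 z.1 : ℝ) : ℂ)) 2 (volume.prod P) :=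
    ((hX.memLp i 0).ofReal (K := ℂ)).comp_measurePreserving Measure.measurePreserving_swap
  have h2 := memLp_integral_mul h1 (memLp_const (1 : ℂ))
  simp only [mul_one, integral_complex_ofReal] at h2
  exact h2

lemma WeaklyStationary.memLp_centredFun (hX : WeaklyStationary P X) (i : Fin p) (j : ℤ) :
    MemLp (centredFun P X i j) 2 (P.prod volume) := by
  have h := ((hX.memLp i j).ofReal (K := ℂ)).sub ((hX.memLp_mean i).comp_snd P)
  refine h.ae_eq (ae_of_all _ fun z => ?_)
  simp [centredFun, centred]

lemma WeaklyStationary.memLp_autocov (hX : WeaklyStationary P X) (hsum : SummableAutocov P X)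
    (i : Fin p) (h : ℤ) :
    MemLp (fun z : unitInterval × unitInterval => (autocov P X i i h z.1 z.2 : ℂ)) 2
      ((volume : Measure unitInterval).prod (volume : Measure unitInterval)) := by
  refine ⟨(aestronglyMeasurable_integral_mul (memLp_conj (hX.memLp_centredFun i (0 + h)))
    (hX.memLp_centredFun i 0)).congr (hX.integral_centredFun_mul i 0 h), ?_⟩
  rw [eLpNorm_ofReal (fun z : unitInterval × unitInterval => autocov P X i i h z.1 z.2)]
  exact (ENNReal.ne_top_of_tsum_ne_top (hsum.tsum_ne_top i) h).lt_top

/-- The centred series in `L²(Ω × [0,1])`. -/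
def centredLp (hX : WeaklyStationary P X) (i : Fin p) (j : ℤ) :
    Lp ℂ 2 (P.prod (volume : Measure unitInterval)) :=
  (hX.memLp_centredFun i j).toLp _

/-- The functionals `u ↦ ⟨ε_{ij}, u⟩`. -/
def coef (hX : WeaklyStationary P X) (i : Fin p) (j : ℤ) :
    Lp ℂ 2 (volume : Measure unitInterval) →L[ℂ] Lp ℂ 2 P :=
  coefLp (hX.memLp_centredFun i j)

/-- The autocovariance kernels in `L²([0,1]²)`. -/
def autocovLp (hX : WeaklyStationary P X) (hsum : SummableAutocov P X) (i : Fin p) (h : ℤ) :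
    Lp ℂ 2 ((volume : Measure unitInterval).prod (volume : Measure unitInterval)) :=
  (hX.memLp_autocov hsum i h).toLp _

/-- The autocovariance operators, as products of the functionals `coef`. -/
def autocovOp (hX : WeaklyStationary P X) (i : Fin p) (h : ℤ) :
    Lp ℂ 2 (volume : Measure unitInterval) →L[ℂ] Lp ℂ 2 (volume : Measure unitInterval) :=
  (ContinuousLinearMap.adjoint (coef hX i 0)).comp (coef hX i h)

lemma inner_coef (hX : WeaklyStationary P X) (hsum : SummableAutocov P X) (i : Fin p) (j h : ℤ)
    (u v : Lp ℂ 2 (volume : Measure unitInterval)) :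
    ⟪coef hX i j v, coef hX i (j + h) u⟫_ℂ = ⟪testKernel u v, autocovLp hX hsum i h⟫_ℂ :=
  inner_coefLp _ _ u v _ (hX.integral_centredFun_mul i j h)

lemma inner_autocovOp (hX : WeaklyStationary P X) (hsum : SummableAutocov P X) (i : Fin p) (h : ℤ)
    (u v : Lp ℂ 2 (volume : Measure unitInterval)) :
    ⟪v, autocovOp hX i h u⟫_ℂ = ⟪testKernel u v, autocovLp hX hsum i h⟫_ℂ := by
  rw [autocovOp, ContinuousLinearMap.comp_apply, ContinuousLinearMap.adjoint_inner_right,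
    ← inner_coef hX hsum i 0 h, zero_add]

lemma summable_norm_autocovLp (hX : WeaklyStationary P X) (hsum : SummableAutocov P X)
    (i : Fin p) : Summable fun h => ‖autocovLp hX hsum i h‖ := by
  have := ENNReal.summable_toReal (hsum.tsum_ne_top i)
  refine this.congr fun h => ?_
  rw [autocovLp, Lp.norm_toLp,
    eLpNorm_ofReal (fun z : unitInterval × unitInterval => autocov P X i i h z.1 z.2)]

/-- Stationarity, with the operator norms of the autocovariances bounded by the `L²` norms of
their kernels. -/
lemma isCovariance_coef (hX : WeaklyStationary P X) (hsum : SummableAutocov P X) (i : Fin p) :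
    IsCovariance (coef hX i) (autocovOp hX i) := by
  refine ⟨fun j h u v => by rw [inner_coef hX hsum, inner_autocovOp hX hsum], ?_⟩
  refine Summable.of_nonneg_of_le (fun _ => norm_nonneg _) (fun h => ?_)
    (summable_norm_autocovLp hX hsum i)
  refine ContinuousLinearMap.opNorm_le_bound _ (norm_nonneg _) fun u => ?_
  set y := autocovOp hX i h u with hy
  have h1 : ‖y‖ ^ 2 ≤ ‖y‖ * (‖autocovLp hX hsum i h‖ * ‖u‖) := by
    calc ‖y‖ ^ 2 = ‖⟪y, y⟫_ℂ‖ := by rw [inner_self_eq_norm_sq_to_K, norm_pow]; simp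
      _ = ‖⟪testKernel u y, autocovLp hX hsum i h⟫_ℂ‖ := by
        rw [← inner_autocovOp hX hsum, ← hy]
      _ ≤ ‖testKernel u y‖ * ‖autocovLp hX hsum i h‖ := norm_inner_le_norm _ _
      _ = _ := by rw [norm_testKernel]; ring
  -- cancel one factor `‖y‖`
  rcases (norm_nonneg y).eq_or_lt with h0 | h0
  · rw [← h0]; positivity
  · rw [pow_two] at h1
    exact le_of_mul_le_mul_left h1 h0

/-- The spectral density kernel in `L²([0,1]²)`. -/
def spectralKernel (hX : WeaklyStationary P X) (hsum : SummableAutocov P X) (i : Fin p) (ω : ℝ) :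
    Lp ℂ 2 ((volume : Measure unitInterval).prod (volume : Measure unitInterval)) :=
  (1 / (2 * (Real.pi : ℂ))) • ∑' h, char h ω • autocovLp hX hsum i h

lemma norm_char_smul {E : Type*} [NormedAddCommGroup E] [NormedSpace ℂ E] (h : ℤ) (ω : ℝ)
    (x : E) : ‖char h ω • x‖ = ‖x‖ := by
  rw [norm_smul, norm_char, one_mul]

/-- The spectral density operator has the spectral density as its kernel. -/
lemma inner_spectralOp_autocovOp (hX : WeaklyStationary P X) (hsum : SummableAutocov P X)
    (i : Fin p) (ω : ℝ) (u v : Lp ℂ 2 (volume : Measure unitInterval)) :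
    ⟪v, spectralOp (autocovOp hX i) ω u⟫_ℂ = ⟪testKernel u v, spectralKernel hX hsum i ω⟫_ℂ := by
  have h1 := hasSum_inner_spectralOp (isCovariance_coef hX hsum i).summable ω u v
  have h2 : Summable fun h => char h ω • autocovLp hX hsum i h :=
    Summable.of_norm (by simpa only [norm_char_smul] using summable_norm_autocovLp hX hsum i)
  have h3 := (innerSL ℂ (testKernel u v)).hasSum (h2.hasSum.const_smul (1 / (2 * (Real.pi : ℂ))))
  simp only [innerSL_apply_apply, inner_smul_right] at h3
  rw [spectralKernel, inner_smul_right]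
  refine h1.unique (h3.congr_fun fun h => ?_)
  rw [inner_autocovOp hX hsum]

lemma spectralKernel_coeFn (hX : WeaklyStationary P X) (hsum : SummableAutocov P X)
    (i : Fin p) (ω : ℝ) :
    spectralKernel hX hsum i ω
      =ᵐ[(volume : Measure unitInterval).prod (volume : Measure unitInterval)]
        fun z => spectralDensity P X i i ω z.1 z.2 := by
  have h1 : ∑' h, ‖char h ω • autocovLp hX hsum i h‖ₑ ≠ ⊤ := by
    rw [tsum_enorm_ne_top_iff_summable_norm]
    simpa only [norm_char_smul] using summable_norm_autocovLp hX hsum i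
  have h2 : ∀ᵐ z ∂((volume : Measure unitInterval).prod (volume : Measure unitInterval)),
      ∀ h, (char h ω • autocovLp hX hsum i h : Lp ℂ 2 _) z
        = (autocov P X i i h z.1 z.2 : ℂ) * char h ω := by
    rw [ae_all_iff]
    intro h
    filter_upwards [Lp.coeFn_smul (char h ω) (autocovLp hX hsum i h),
      (hX.memLp_autocov hsum i h).coeFn_toLp] with z h3 h4
    rw [h3, Pi.smul_apply, autocovLp, h4, smul_eq_mul, mul_comm]
  filter_upwards [Lp.coeFn_smul (1 / (2 * (Real.pi : ℂ)))
    (∑' h, char h ω • autocovLp hX hsum i h), Lp.coeFn_tsum h1, h2] with z h3 h4 h5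
  rw [spectralKernel, h3, Pi.smul_apply, h4, smul_eq_mul, spectralDensity]
  simp only [h5]
  rfl

end Series

/-! ### The spectral decomposition -/

section Decomposition

variable {Ω : Type*} [MeasurableSpace Ω] {P : Measure Ω} [IsProbabilityMeasure P] {p : ℕ}
  {X : Fin p → ℤ → Ω → unitInterval → ℝ} {η : ℕ → ℝ → ℝ} {ψ : ℕ → ℝ → unitInterval → ℂ}

open Classical in
/-- The eigenfunction `ψ_k(· | ω)` in `L²`, set to `0` at the exceptional frequencies where it is
not square integrable. -/
def eigenLp (ψ : ℕ → ℝ → unitInterval → ℂ) (ω : ℝ) (k : ℕ) :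
    Lp ℂ 2 (volume : Measure unitInterval) :=
  if h : MemLp (ψ k ω) 2 volume then h.toLp _ else 0

lemma eigenLp_eq {ω : ℝ} {k : ℕ} (h : MemLp (ψ k ω) 2 volume) : eigenLp ψ ω k = h.toLp _ :=
  dif_pos h

lemma star_toLp_inner {β : Type*} [MeasurableSpace β] {ν : Measure β} (u v : Lp ℂ 2 ν) :
    ⟪star u, star v⟫_ℂ = ⟪v, u⟫_ℂ := by
  rw [inner_eq_integral, inner_eq_integral]
  refine integral_congr_ae ?_
  filter_upwards [Lp.coeFn_star u, Lp.coeFn_star v] with t h1 h2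
  rw [h1, h2, Pi.star_apply, Pi.star_apply, ← starRingEnd_apply, ← starRingEnd_apply,
    Complex.conj_conj, mul_comm]

lemma IsSpectralDecomposition.orthonormal_eigenLp {g : ℝ → unitInterval → unitInterval → ℂ}
    (hψ : IsSpectralDecomposition g η ψ) : ∀ᵐ ω ∂freq, Orthonormal ℂ (eigenLp ψ ω) := by
  filter_upwards [hψ.memLp, hψ.orthonormal] with ω h1 h2
  rw [orthonormal_iff_ite]
  intro k m
  rw [eigenLp_eq (h1 k), eigenLp_eq (h1 m), inner_toLp, h2]

/-- The spectral density operators of the components add up to `p` times the operator of the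
marginal spectral density, hence have the eigenvalues `p * η k` and the eigenvectors `ψ k`. -/
lemma hasWeakExpansion_spectralOp (hX : WeaklyStationary P X) (hsum : SummableAutocov P X)
    (hψ : IsSpectralDecomposition (marginalSpectralDensity P X) η ψ) :
    ∀ᵐ ω ∂freq, HasWeakExpansion (∑ i, spectralOp (autocovOp hX i) ω) (fun k => p * η k ω)
      (eigenLp ψ ω) := by
  filter_upwards [hψ.memLp, hψ.expansion] with ω h1 h2 u v
  let F : ℕ → Lp ℂ 2 ((volume : Measure unitInterval).prod (volume : Measure unitInterval)) :=
    fun n => ∑ k ∈ Finset.range n, (η k ω : ℂ) • testKernel (eigenLp ψ ω k) (eigenLp ψ ω k)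
  have hF : ∀ n, F n =ᵐ[(volume : Measure unitInterval).prod (volume : Measure unitInterval)]
      fun z => ∑ k ∈ Finset.range n, (η k ω : ℂ) * conj (ψ k ω z.1) * ψ k ω z.2 := fun n => by
    have h3 : ∀ᵐ z ∂((volume : Measure unitInterval).prod (volume : Measure unitInterval)), ∀ k,
        ((η k ω : ℂ) • testKernel (eigenLp ψ ω k) (eigenLp ψ ω k) : Lp ℂ 2 _) z
          = (η k ω : ℂ) * conj (ψ k ω z.1) * ψ k ω z.2 := by
      rw [ae_all_iff]
      intro k
      filter_upwards [Lp.coeFn_smul (η k ω : ℂ) (testKernel (eigenLp ψ ω k) (eigenLp ψ ω k)),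
        testKernel_coeFn (eigenLp ψ ω k) (eigenLp ψ ω k),
        Measure.quasiMeasurePreserving_fst.ae (h1 k).coeFn_toLp,
        Measure.quasiMeasurePreserving_snd.ae (h1 k).coeFn_toLp] with z h4 h5 h6 h7
      rw [h4, Pi.smul_apply, h5, eigenLp_eq (h1 k), h6, h7, smul_eq_mul]
      ring
    filter_upwards [h3, sum_coeFn_ae (Finset.range n) fun k =>
      (η k ω : ℂ) • testKernel (eigenLp ψ ω k) (eigenLp ψ ω k)] with z h4 h5
    rw [h5, Finset.sum_congr rfl fun k _ => h4 k]
  have hg : ∀ᵐ z ∂((volume : Measure unitInterval).prod (volume : Measure unitInterval)),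
      (((1 / (p : ℂ)) • ∑ i, spectralKernel hX hsum i ω : Lp ℂ 2 _)) z
        = marginalSpectralDensity P X ω z.1 z.2 := by
    have h3 := ae_all_iff.2 fun i => spectralKernel_coeFn hX hsum i ω
    filter_upwards [Lp.coeFn_smul (1 / (p : ℂ)) (∑ i, spectralKernel hX hsum i ω),
      sum_coeFn_ae Finset.univ fun i => spectralKernel hX hsum i ω, h3] with z h4 h5 h6
    rw [h4, Pi.smul_apply, h5, marginalSpectralDensity, smul_eq_mul,
      Finset.sum_congr rfl fun i _ => h6 i]
  have hlim : Tendsto F atTop (𝓝 ((1 / (p : ℂ)) • ∑ i, spectralKernel hX hsum i ω)) := by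
    rw [Lp.tendsto_Lp_iff_tendsto_eLpNorm']
    refine h2.congr fun n => ?_
    rw [← eLpNorm_neg]
    refine eLpNorm_congr_ae ?_
    filter_upwards [hF n, hg] with z h3 h4
    rw [Pi.neg_apply, Pi.sub_apply, h3, h4, neg_sub]
  have h5 := ((innerSL ℂ (testKernel u v)).continuous.tendsto _).comp hlim
  have h6 := h5.const_mul (p : ℂ)
  have e1 : (p : ℂ) * innerSL ℂ (testKernel u v) ((1 / (p : ℂ)) • ∑ i, spectralKernel hX hsum i ω)
      = ⟪v, (∑ i, spectralOp (autocovOp hX i) ω) u⟫_ℂ := by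
    simp only [innerSL_apply_apply, inner_smul_right, inner_sum, sum_apply,
      inner_spectralOp_autocovOp hX hsum]
    -- for `p = 0` the factor `1 / p` is a junk value, but both sides are empty sums
    rcases Nat.eq_zero_or_pos p with hp | hp
    · subst hp; simp
    · have : (p : ℂ) ≠ 0 := by exact_mod_cast hp.ne'
      field_simp
  rw [e1] at h6
  refine h6.congr fun n => ?_
  simp only [Function.comp, F, innerSL_apply_apply, inner_sum, inner_smul_right, Finset.mul_sum]
  refine Finset.sum_congr rfl fun k _ => ?_
  rw [testKernel, testKernel, inner_tensorLp, star_toLp_inner]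
  push_cast
  ring

variable {ν : ℕ → ℝ → ℂ}

/-- The transfer function `ψ(t | ω) ν(ω)`. -/
def transferFun (ψ : ℝ → unitInterval → ℂ) (ν : ℝ → ℂ) (z : ℝ × unitInterval) : ℂ :=
  ψ z.1 z.2 * ν z.1

lemma IsUnitMultiplier.ae_norm {ν : ℝ → ℂ} (hν : IsUnitMultiplier ν) : ∀ᵐ ω ∂freq, ‖ν ω‖ = 1 :=
  ae_restrict_of_forall_mem measurableSet_Icc hν.norm_eq_one

lemma IsSpectralDecomposition.transfer_ae {g : ℝ → unitInterval → unitInterval → ℂ}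
    (hψ : IsSpectralDecomposition g η ψ) (k : ℕ) :
    ∀ᵐ ω ∂freq, (ν k ω • eigenLp ψ ω k : Lp ℂ 2 (volume : Measure unitInterval)) =ᵐ[volume]
      fun t => transferFun (ψ k) (ν k) (ω, t) := by
  filter_upwards [hψ.memLp] with ω h1
  filter_upwards [Lp.coeFn_smul (ν k ω) (eigenLp ψ ω k), (h1 k).coeFn_toLp] with t h2 h3
  rw [h2, Pi.smul_apply, eigenLp_eq (h1 k), h3, smul_eq_mul, mul_comm, transferFun]

lemma IsSpectralDecomposition.norm_transfer {g : ℝ → unitInterval → unitInterval → ℂ}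
    (hψ : IsSpectralDecomposition g η ψ) {k : ℕ} (hν : IsUnitMultiplier (ν k)) :
    ∀ᵐ ω ∂freq, ‖ν k ω • eigenLp ψ ω k‖ = 1 := by
  filter_upwards [hψ.orthonormal_eigenLp, hν.ae_norm] with ω h1 h2
  rw [norm_smul, h1.1, h2, one_mul]

lemma IsSpectralDecomposition.memLp_transferFun {g : ℝ → unitInterval → unitInterval → ℂ}
    (hψ : IsSpectralDecomposition g η ψ) {k : ℕ} (hν : IsUnitMultiplier (ν k)) :
    MemLp (transferFun (ψ k) (ν k)) 2 (freq.prod volume) := by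
  have hm : AEStronglyMeasurable (transferFun (ψ k) (ν k)) (freq.prod volume) :=
    (hψ.aestronglyMeasurable k).mul hν.aestronglyMeasurable.comp_fst
  refine memLp_two_of_lintegral_lt_top hm ?_
  rw [lintegral_prod _ (hm.enorm.pow_const 2)]
  have h1 : ∀ᵐ ω ∂freq, ∫⁻ t, ‖transferFun (ψ k) (ν k) (ω, t)‖ₑ ^ 2 = 1 := by
    filter_upwards [hψ.transfer_ae (ν := ν) k, hψ.norm_transfer hν] with ω h2 h3
    have h4 := ofReal_norm_toLp_sq (Lp.memLp (ν k ω • eigenLp ψ ω k))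
    rw [Lp.toLp_coeFn, h3] at h4
    rw [one_pow, ENNReal.ofReal_one] at h4
    rw [h4]
    exact lintegral_congr_ae (h2.mono fun t ht => by simp only [ht])
  rw [lintegral_congr_ae h1, lintegral_one]
  exact measure_lt_top _ _

/-- The optimal filters are real. -/
lemma IsSpectralDecomposition.conj_functionalFilter {g : ℝ → unitInterval → unitInterval → ℂ}
    (hψ : IsSpectralDecomposition g η ψ) {k : ℕ} (hν : IsUnitMultiplier (ν k)) (l : ℤ) :
    ∀ᵐ t, conj (functionalFilter (ψ k) (ν k) l t) = functionalFilter (ψ k) (ν k) l t := by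
  refine conj_fourierFilter (hψ.memLp_transferFun hν).1 ?_ l
  have h1 : ∀ᵐ ω ∂freq, ν k ω = conj (ν k (-ω)) :=
    ae_restrict_of_forall_mem measurableSet_Icc hν.conj_symm
  filter_upwards [hψ.conj_symm k, h1] with ω h2 h3
  filter_upwards [h2] with t ht
  simp only [transferFun]
  rw [map_mul, ht, h3, Complex.conj_conj]

end Decomposition

/-! ### Partial sums and mean squared errors in L² -/

section Assembly

variable {Ω : Type*} [MeasurableSpace Ω] {P : Measure Ω}

/-- The partial sums of the reconstruction series, as elements of `L²`. -/
lemma reconSum_tensorLp_coeFn {φ : ℤ → unitInterval → ℂ} (hφ : ∀ l, MemLp (φ l) 2 volume)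
    {ξ : ℤ → Ω → ℂ} (hξ : ∀ m, MemLp (ξ m) 2 P) (j : ℤ) (L : ℕ) :
    (reconSum tensorLp (fun l => (hφ l).toLp _) (fun m => (hξ m).toLp _) (window L) j :
      Lp ℂ 2 (P.prod volume)) =ᵐ[P.prod volume] reconPartial φ ξ j L := by
  have h1 : ∀ᵐ z ∂(P.prod volume), ∀ l, tensorLp ((hφ l).toLp _) ((hξ (j + l)).toLp _) z
      = φ l z.2 * ξ (j + l) z.1 := by
    rw [ae_all_iff]
    exact fun l => tensorLp_toLp _ _
  filter_upwards [h1, sum_coeFn_ae (window L) fun l =>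
    tensorLp ((hφ l).toLp _) ((hξ (j + l)).toLp _)] with z h2 h3
  rw [reconSum, h3, reconPartial, symSum_eq]
  exact Finset.sum_congr rfl fun l _ => h2 l

variable [IsProbabilityMeasure P] {p : ℕ} {X : Fin p → ℤ → Ω → unitInterval → ℝ}

/-- The partial sums of the score series, as elements of `L²`. -/
lemma scoreSum_coef_coeFn (hX : WeaklyStationary P X) (i : Fin p) {v : ℤ → unitInterval → ℂ}
    (hv : ∀ l, MemLp (v l) 2 volume) (j : ℤ) (L : ℕ) :
    (scoreSum (coef hX i) (fun l => (hv l).toLp _) (window L) j : Lp ℂ 2 P)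
      =ᵐ[P] scorePartial (centred P X i) v j L := by
  have h1 : ∀ᵐ w ∂P, ∀ l, coef hX i (j - l) ((hv l).toLp _) w
      = ∫ t, conj ((centred P X i (j - l) w t : ℝ) : ℂ) * v l t := by
    rw [ae_all_iff]
    intro l
    rw [coef, coefLp_apply]
    exact MemLp.coeFn_toLp _
  filter_upwards [h1, sum_coeFn_ae (window L) fun l => coef hX i (j - l) ((hv l).toLp _)]
    with w h2 h3
  rw [scoreSum, h3, scorePartial, symSum_eq]
  exact Finset.sum_congr rfl fun l _ => h2 l

lemma meanSqError_eq (hX : WeaklyStationary P X) (j : ℤ) {K : ℕ}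
    {Y : Fin p → Fin K → Ω → unitInterval → ℂ}
    {y : Fin p → Fin K → Lp ℂ 2 (P.prod (volume : Measure unitInterval))}
    (hy : ∀ i k, y i k =ᵐ[P.prod volume] fun z => Y i k z.1 z.2) :
    meanSqError P (fun i => centred P X i j) (fun i w t => ∑ k, Y i k w t)
      = ENNReal.ofReal (∑ i, ‖centredLp hX i j - ∑ k, y i k‖ ^ 2) := by
  have h1 : ∀ i, (centredLp hX i j - ∑ k, y i k : Lp ℂ 2 _) =ᵐ[P.prod volume]
      fun z => (centred P X i j z.1 z.2 : ℂ) - ∑ k, Y i k z.1 z.2 := fun i => by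
    filter_upwards [Lp.coeFn_sub (centredLp hX i j) (∑ k, y i k),
      (hX.memLp_centredFun i j).coeFn_toLp, sum_coeFn_ae Finset.univ (y i),
      ae_all_iff.2 (hy i)] with z h2 h3 h4 h5
    rw [h2, Pi.sub_apply, centredLp, h3, h4, Finset.sum_congr rfl fun k _ => h5 k, centredFun]
  have hm : ∀ i, AEMeasurable (fun z : Ω × unitInterval =>
      ‖(centred P X i j z.1 z.2 : ℂ) - ∑ k, Y i k z.1 z.2‖ₑ ^ 2) (P.prod volume) := fun i =>
    ((Lp.aestronglyMeasurable _).congr (h1 i)).enorm.pow_const 2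
  rw [meanSqError, lintegral_finsetSum' _ fun i _ => (hm i).lintegral_prod_right',
    ENNReal.ofReal_sum_of_nonneg fun i _ => sq_nonneg _]
  refine Finset.sum_congr rfl fun i _ => ?_
  have h2 := ofReal_norm_toLp_sq (Lp.memLp (centredLp hX i j - ∑ k, y i k))
  rw [Lp.toLp_coeFn] at h2
  rw [h2, ← lintegral_prod _ (hm i)]
  exact lintegral_congr_ae ((h1 i).mono fun z hz => by simp only [hz])

lemma isRealFilter_toLp (hX : WeaklyStationary P X) (i : Fin p) {κ : Type*}
    {φ : κ → ℤ → unitInterval → ℂ} (hφ : ∀ k l, MemLp (φ k l) 2 volume)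
    (hr : ∀ k l, ∀ᵐ t, conj (φ k l t) = φ k l t) :
    IsRealFilter (coef hX i) (centredLp hX i) tensorLp fun k l => (hφ k l).toLp _ := by
  have h : ∀ k l, ∀ᵐ t, conj ((hφ k l).toLp (φ k l) t) = (hφ k l).toLp (φ k l) t := fun k l => by
    filter_upwards [(hφ k l).coeFn_toLp, hr k l] with t h1 h2
    rw [h1, h2]
  exact ⟨fun k l k' l' => inner_comm_of_real (h k l) (h k' l'),
    fun j k l x => inner_toLp_tensorLp _ (conj_centredFun i j) (h k l) x⟩

end Assembly

end FTS

end

theorem theorem1 {Ω : Type*} [MeasurableSpace Ω] (P : MeasureTheory.Measure Ω)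
    [MeasureTheory.IsProbabilityMeasure P] (p : ℕ)
    (X : Fin p → ℤ → Ω → unitInterval → ℝ)
    (hX : FTS.WeaklyStationary P X) (hsum : FTS.SummableAutocov P X)
    (η : ℕ → ℝ → ℝ) (ψ : ℕ → ℝ → unitInterval → ℂ)
    (hψ : FTS.IsSpectralDecomposition (FTS.marginalSpectralDensity P X) η ψ)
    (ν : ℕ → ℝ → ℂ) (hν : ∀ k, FTS.IsUnitMultiplier (ν k)) :
    -- the marginal dynamic Karhunen–Loève expansion: its series converge in mean square
    ∃ (ξ : Fin p → ℤ → ℕ → Ω → ℂ) (Y : Fin p → ℤ → ℕ → Ω → unitInterval → ℂ),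
      FTS.IsFilterExpansion P (FTS.centred P X)
        (fun k => FTS.functionalFilter (ψ k) (ν k))
        (fun k => FTS.functionalFilter (ψ k) (ν k)) ξ Y ∧
      -- its truncation to `K` components is optimal
      ∀ K : ℕ, 0 < K →
        ∀ φ' v' : Fin K → ℤ → unitInterval → ℝ,
          (∀ k, FTS.FourierSummable (φ' k)) → (∀ k, FTS.FourierSummable (v' k)) →
        ∀ (ξ' : Fin p → ℤ → Fin K → Ω → ℂ) (Y' : Fin p → ℤ → Fin K → Ω → unitInterval → ℂ),
          FTS.IsFilterExpansion P (FTS.centred P X)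
            (fun k l t => (φ' k l t : ℂ)) (fun k l t => (v' k l t : ℂ)) ξ' Y' →
        ∀ j : ℤ,
          FTS.meanSqError P (fun i => FTS.centred P X i j)
              (fun i w t => ∑ k : Fin K, Y i j k w t) ≤
            FTS.meanSqError P (fun i => FTS.centred P X i j)
              (fun i w t => ∑ k : Fin K, Y' i j k w t) := by
  open FTS in
  have hcov := isCovariance_coef hX hsum
  have hG := fun k => hψ.memLp_transferFun (hν k)
  have hf : ∀ k l, MemLp (functionalFilter (ψ k) (ν k) l) 2 volume :=
    fun k l => memLp_fourierFilter (hG k) l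
  have htr : ∀ k, IsTransfer (fun l => (hf k l).toLp _) fun ω => ν k ω • eigenLp ψ ω k :=
    fun k => isTransfer_filterLp (hG k) (hψ.transfer_ae k) (hψ.norm_transfer (hν k))
  have hreal := fun k => hψ.conj_functionalFilter (hν k)
  -- the limits of the scores and of the reconstructions
  let ξL : Fin p → ℕ → ℤ → Lp ℂ 2 P := fun i k j =>
    ∑' m, coef hX i (j - m) ((hf k m).toLp _)
  have hξ : ∀ i k m, Tendsto (fun M => scoreSum (coef hX i) (fun l => (hf k l).toLp _)
      (window M) m) atTop (𝓝 (ξL i k m)) := fun i k m =>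
    ((hcov i).summable_score (htr k).summable m).hasSum.comp tendsto_window
  let YL : Fin p → ℤ → ℕ → Lp ℂ 2 (P.prod (volume : Measure unitInterval)) := fun i j k =>
    ∑' l, tensorLp ((hf k l).toLp _) (ξL i k (j + l))
  have hY : ∀ i j k, Tendsto (fun L => reconSum tensorLp (fun l => (hf k l).toLp _)
      (ξL i k) (window L) j) atTop (𝓝 (YL i j k)) := fun i j k =>
    ((hcov i).summable_recon inner_tensorLp (isRealFilter_toLp hX i (fun _ : Unit => hf k)
      fun _ => hreal k) (htr k) (hξ i k) j).hasSum.comp tendsto_window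
  refine ⟨fun i j k => ξL i k j, fun i j k w t => YL i j k (w, t), ⟨fun i j k => ?_,
    fun i j k => ?_⟩, fun K _ φ' v' hφ' hv' ξ' Y' h' j => ?_⟩
  · exact IsMSLimit.of_tendsto (scoreSum_coef_coeFn hX i (hf k) j) (hξ i k j)
  · refine IsMSLimit.of_tendsto (fun L => ?_) (hY i j k)
    have := reconSum_tensorLp_coeFn (hf k) (fun m => Lp.memLp (ξL i k m)) j L
    simpa only [Lp.toLp_coeFn] using this
  · have hφm : ∀ k l, MemLp (fun t => (φ' k l t : ℂ)) 2 (volume : Measure unitInterval) :=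
      fun k l => ((hφ' k).1 l).ofReal
    have hvm : ∀ k l, MemLp (fun t => (v' k l t : ℂ)) 2 (volume : Measure unitInterval) :=
      fun k l => ((hv' k).1 l).ofReal
    have hξm := fun i j k => (h'.score i j k).1
    rw [meanSqError_eq hX j (y := fun i k => YL i j k) fun i k => ae_of_all _ fun z => rfl,
      meanSqError_eq hX j (y := fun i k => (h'.recon i j k).1.toLp _)
        fun i k => (h'.recon i j k).1.coeFn_toLp]
    refine ENNReal.ofReal_le_ofReal (sum_norm_sub_sq_le hcov inner_tensorLp
      (hasWeakExpansion_spectralOp hX hsum hψ) hψ.orthonormal_eigenLp ?_ ?_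
      (c := fun k => ν k) (ae_all_iff.2 fun k => (hν k).ae_norm) (fun k => htr k)
      (fun i => isRealFilter_toLp hX i (fun k : Fin K => hf k) fun k => hreal k)
      (fun i k m => hξ i k m) (fun i k => hY i j k)
      (fun i => isRealFilter_toLp hX i hφm fun k l => ae_of_all _ fun t => Complex.conj_ofReal _)
      (fun i k m => IsMSLimit.tendsto_toLp (scoreSum_coef_coeFn hX i (hvm k) m) (h'.score i m k))
      fun i k => IsMSLimit.tendsto_toLp (reconSum_tensorLp_coeFn (hφm k)
        (fun m => hξm i m k) j) (h'.recon i j k))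
    · filter_upwards [hψ.nonneg] with ω h k
      exact mul_nonneg (Nat.cast_nonneg p) (h k)
    · filter_upwards [hψ.antitone] with ω h k m hkm
      exact mul_le_mul_of_nonneg_left (h hkm) (Nat.cast_nonneg p)
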